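/- Let $(\xi_i)_{i\in\mathbb N}$ be a sequence of square integrable real random variables on a probability space $(E,\mathcal E,\mu)$ which is strictly stationary (or, more generally, stationary of order two, i.e. with constant mean and with $\operatorname{Cov}(\xi_i,\xi_{i+k})=\operatorname{Cov}(\xi_0,\xi_k)$ for all $i,k$, and such that the family $\{\xi_i^2\}$ is uniformly integrable). Put $m=\mathbb E_\mu(\xi_0)$ and $\mathcal M_i=\sigma(\xi_j,\ j\le i)$. For a random vector $Y$ in $\mathbb R^l$ and a $\sigma$-algebra $\mathcal M\subset\mathcal E$ let $\theta_2(\mathcal M,Y)=\sup_f\|\mathbb E_\mu(f(Y)\mid\mathcal M)-\mathbb E_\mu(f(Y))\|_2$, the supremum being over all $f:\mathbb R^l\to\mathbb R$ with $|f(x)-f(y)|\le\sum_{i=1}^l|x_i-y_i|$, and let $$\theta_2(n)=\sup_{l\ge1}\ \frac1l\ \sup\{\theta_2(\mathcal M_p,(\xi_{j_1},\dots,\xi_{j_l})):\ p+n\le j_1<\dots<j_l\}.$$ Assume that $\theta_2(n)\le g(n)$ for all $n\ge1$, where $g:(0,\infty)\to[0,\infty)$ is such that $x\mapsto x^{3/2}g(x)$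 is non-increasing and $\sum_{i=0}^\infty2^{3i/2}g(2^{i\varepsilon})<\infty$ for some $0<\varepsilon<1$. Let $(X_i)_{i\ge1}$ be i.i.d. random variables on a probability space $(\Omega,\mathcal A,\mathbb P)$ with values in $\mathbb N^*=\{1,2,\dots\}$ almost surely, and let $S_0=0$, $S_n=X_1+\dots+X_n$ and $G(0,x)=\sum_{k\ge0}\mathbb P(S_k=x)$. Assume that $$\sigma^2=2\sum_{x\in\mathbb N}G(0,x)\operatorname{Cov}(\xi_0,\xi_x)-\operatorname{Var}(\xi_0)$$ is finite (the series converges absolutely) and positive. Let $\hat m_n=\frac1n\sum_{i=1}^n\xi_{S_i}$, a random variable on $(\Omega\times E,\mathbb P\otimes\mu)$. Then the limit $a(S)=\lim_{n\to\infty}n\operatorname{Var}_{\mathbb P\otimes\mu}(\hat m_n)$ exists in $[0,\infty)$ and, for $\mathbb P$-almost every $\omega\in\Omega$, the random variables $\sqrt n\,(\hat m_n(\omega,\cdot)-m)$ on $(E,\mu)$ satisfy $$\sqrt n\,(\hat m_n(\omega,\cdot)-m)\longrightarrow\mathcal N(0,a(S))\quad\text{in distribution as } n\to\infty.$$ -/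

import Mathlib

open MeasureTheory ProbabilityTheory Filter
open scoped Topology NNReal ENNReal

namespace SampledCLT

noncomputable section

/-! ### Weak dependence coefficients -/

section Dependence

variable {E : Type*} [mE : MeasurableSpace E]

/-- Functions `f : ℝ^l → ℝ` with Lipschitz modulus at most one for the metric
`d₁(x, y) = ∑ i, |x i - y i|`. -/
def LipOne (l : ℕ) (f : (Fin l → ℝ) → ℝ) : Prop :=
  ∀ x y : Fin l → ℝ, |f x - f y| ≤ ∑ i, |x i - y i|

/-- The coefficient `θ₂(M, Y) = sup { ‖E(f(Y) | M) - E(f(Y))‖₂ : Lip(f) ≤ 1 }` of an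
`ℝ^l`-valued random variable `Y` and a sub-σ-algebra `M`. -/
def theta2 (μ : Measure E) (M : MeasurableSpace E) {l : ℕ} (Y : E → Fin l → ℝ) : ℝ≥0∞ :=
  ⨆ (f : (Fin l → ℝ) → ℝ) (_ : LipOne l f),
    eLpNorm (fun x => (condExp M μ (fun y => f (Y y))) x - ∫ y, f (Y y) ∂μ) 2 μ

/-- The σ-algebra `σ(ξ_j, j ≤ i)` of the past of the process up to time `i`. -/
def past (ξ : ℕ → E → ℝ) (i : ℕ) : MeasurableSpace E :=
  ⨆ (j : ℕ) (_ : j ≤ i), MeasurableSpace.comap (ξ j) inferInstance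

/-- `θ_{k,2}(n)`: the maximum over `1 ≤ l ≤ k` of
`l⁻¹ sup { θ₂(σ(ξ_i, i ≤ p), (ξ_{j_1}, …, ξ_{j_l})) : p + n ≤ j_1 < … < j_l }`. -/
def thetaK (μ : Measure E) (ξ : ℕ → E → ℝ) (k n : ℕ) : ℝ≥0∞ :=
  ⨆ (l : ℕ) (_ : 1 ≤ l ∧ l ≤ k), (l : ℝ≥0∞)⁻¹ *
    ⨆ (p : ℕ) (j : Fin l → ℕ) (_ : StrictMono j ∧ ∀ i, p + n ≤ j i),
      theta2 μ (past ξ p) (fun x i => ξ (j i) x)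

/-- `θ₂(n) = sup_{k ≥ 1} θ_{k,2}(n)`. -/
def theta (μ : Measure E) (ξ : ℕ → E → ℝ) (n : ℕ) : ℝ≥0∞ :=
  ⨆ (k : ℕ) (_ : 1 ≤ k), thetaK μ ξ k n

/-- The decay condition on the dependence coefficients: `θ₂(n) ≤ g(n)` for `n ≥ 1`, where `g ≥ 0`,
`x ↦ x^{3/2} g(x)` is non-increasing on `(0, ∞)` and `∑_{i ≥ 0} 2^{3i/2} g(2^{iε}) < ∞` for some
`0 < ε < 1`. -/
def WeakDependence (μ : Measure E) (ξ : ℕ → E → ℝ) : Prop :=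
  ∃ g : ℝ → ℝ,
    (∀ x, 0 < x → 0 ≤ g x) ∧
    (∀ n : ℕ, 1 ≤ n → theta μ ξ n ≤ ENNReal.ofReal (g n)) ∧
    AntitoneOn (fun x : ℝ => x ^ (3 / 2 : ℝ) * g x) (Set.Ioi 0) ∧
    ∃ ε : ℝ, 0 < ε ∧ ε < 1 ∧
      Summable (fun i : ℕ => (2 : ℝ) ^ (3 * (i : ℝ) / 2) * g ((2 : ℝ) ^ ((i : ℝ) * ε)))

/-- Strict stationarity: all time shifts of the process have the same law (on `ℝ^ℕ`). -/
def StrictlyStationary (μ : Measure E) (ξ : ℕ → E → ℝ) : Prop :=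
  ∀ k : ℕ, IdentDistrib (fun x (i : ℕ) => ξ (i + k) x) (fun x (i : ℕ) => ξ i x) μ μ

/-- Stationarity of order two: constant mean, and covariances depending only on the time lag. -/
def SecondOrderStationary (μ : Measure E) (ξ : ℕ → E → ℝ) : Prop :=
  (∀ i : ℕ, ∫ x, ξ i x ∂μ = ∫ x, ξ 0 x ∂μ) ∧
  ∀ i k : ℕ, covariance (ξ i) (ξ (i + k)) μ = covariance (ξ 0) (ξ k) μ

end Dependence

/-! ### The random walk and the sampled empirical mean -/

section Walk

variable {Ω E : Type*} [mΩ : MeasurableSpace Ω] [mE : MeasurableSpace E]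

/-- The random walk `S_0 = 0`, `S_n = X_1 + ⋯ + X_n`; the step `X_{i+1}` is written `X i`. -/
def walk (X : ℕ → Ω → ℕ) (n : ℕ) (ω : Ω) : ℕ :=
  ∑ i ∈ Finset.range n, X i ω

/-- The Green function `G(0, x) = ∑_{k ≥ 0} P(S_k = x)`. -/
def green (P : Measure Ω) (X : ℕ → Ω → ℕ) (x : ℕ) : ℝ :=
  ∑' k : ℕ, P.real {ω | walk X k ω = x}

/-- `σ² = 2 ∑_x G(0, x) Cov(ξ_0, ξ_x) - Var ξ_0`. The walk only visits `ℕ`, so that the sum over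
`ℤ` reduces to a sum over `ℕ`. -/
def sigmaSq (P : Measure Ω) (X : ℕ → Ω → ℕ) (μ : Measure E) (ξ : ℕ → E → ℝ) : ℝ :=
  2 * ∑' x : ℕ, green P X x * covariance (ξ 0) (ξ x) μ - variance (ξ 0) μ

/-- The sampled empirical mean `(1/n) ∑_{i=1}^n ξ_{S_i}`, as a function of the path `ω` of the
walk and of the sample point `x` of the process. -/
def empMean (X : ℕ → Ω → ℕ) (ξ : ℕ → E → ℝ) (n : ℕ) (ω : Ω) (x : E) : ℝ :=
  (1 / (n : ℝ)) * ∑ i ∈ Finset.Icc 1 n, ξ (walk X i ω) x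

end Walk

end

end SampledCLT

namespace SampledCLT

/-! ### From the coefficients `theta` to a covariance inequality -/

section CovDecay

variable {E : Type*} {mE : MeasurableSpace E}

/-! The path of the walk is frozen and a central limit theorem is proved for the non-stationary
sequence `ζ i = ξ (S (i + 1))`; randomness of the walk enters only through the limit of the
variance.

The dependence hypothesis is used in the form `CovDecay`, obtained from `theta` by conditioning and
Cauchy–Schwarz (`covDecay_of_theta`). The steps are at least 1, so almost every path is strictly
increasing; sampling along it only widens gaps, and `CovDecay` passes to `ζ` with the same rate
(`CovDecay.comp`). From the decay condition only two facts are kept: `g` is summable, and `k ^ (3/2)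
* g k` tends to 0.

For such sequences, `CovDecay.tendsto_charFun` gives the Gaussian limit as soon as the variance
divided by `n` converges. Its proof is Bernstein's: truncate, split into big blocks separated by
gaps, factor the characteristic function over the blocks, and compare each factor with a Gaussian
one. Block variances need not be computed, because their sum is close to the variance of the whole
sum.

The variance along a path is a sum over lags `l` of averages of `c (S (i + l) - S i)`, where `c x`
is the covariance of `ξ 0` and `ξ x`. By the strong law each average tends to the expectation of `c
(S l)` (`ae_tendsto_average_walk_increment`), and dominated convergence sums over the lags
(`tendsto_variance_sum_div`). By Fubini the limit is `sigmaSq` (`tsum_green_mul`), which is the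
value of `a`. The variance on the product space has the same limit: the mean given the path is
constant, so this variance is the average of the variances along paths. -/

theorem past_le {ξ : ℕ → E → ℝ} (hξ : ∀ i, Measurable (ξ i)) (p : ℕ) : past ξ p ≤ mE :=
  iSup₂_le fun j _ => (hξ j).comap_le

theorem measurable_past {ξ : ℕ → E → ℝ} {i p : ℕ} (h : i ≤ p) : Measurable[past ξ p] (ξ i) :=
  Measurable.mono (comap_measurable (ξ i))
    (le_iSup₂ (f := fun j (_ : j ≤ p) => MeasurableSpace.comap (ξ j) inferInstance) i h) le_rfl

theorem past_comp_le {ξ : ℕ → E → ℝ} {t : ℕ → ℕ} (ht : StrictMono t) (p : ℕ) :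
    past (fun i => ξ (t i)) p ≤ past ξ (t p) :=
  iSup₂_le fun j hj =>
    le_iSup₂ (f := fun j (_ : j ≤ t p) => MeasurableSpace.comap (ξ j) inferInstance) (t j)
      (ht.monotone hj)

/-- The covariance form of weak dependence: a square integrable variable measurable with respect
to the past and a Lipschitz function of sums over the distant future are almost uncorrelated. -/
def CovDecay (μ : Measure E) (ζ : ℕ → E → ℝ) (g : ℕ → ℝ) : Prop :=
  ∀ p n : ℕ, 1 ≤ n → ∀ B : Finset ℕ, (∀ i ∈ B, p + n ≤ i) → ∀ h φ : ℝ → ℝ,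
    LipschitzWith 1 h → LipschitzWith 1 φ → ∀ W : E → ℝ, Measurable[past ζ p] W → MemLp W 2 μ →
      |∫ x, W x * φ (∑ i ∈ B, h (ζ i x)) ∂μ - (∫ x, W x ∂μ) * ∫ x, φ (∑ i ∈ B, h (ζ i x)) ∂μ|
        ≤ √(∫ x, W x ^ 2 ∂μ) * (B.card * g n)

/-- A strictly increasing time change can only widen gaps: `t p + n ≤ t (p + n)`, and the past of
the sampled process up to `p` lies in the original past up to `t p`. -/
theorem CovDecay.comp {μ : Measure E} {ξ : ℕ → E → ℝ} {g : ℕ → ℝ} (hd : CovDecay μ ξ g)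
    {t : ℕ → ℕ} (ht : StrictMono t) : CovDecay μ (fun i => ξ (t i)) g := by
  intro p n hn B hB h φ hh hφ W hW hW2
  have key := hd (t p) n hn (B.map ⟨t, ht.injective⟩) ?_ h φ hh hφ W
    (hW.mono (past_comp_le ht p) le_rfl) hW2
  · simpa using key
  · intro i hi
    obtain ⟨j, hj, rfl⟩ := Finset.mem_map.1 hi
    have h1 := hB j hj
    have h2 : ∀ k, t p + k ≤ t (p + k) := by
      intro k
      induction k with
      | zero => simp
      | succ k ih =>
        have := ht (Nat.lt_succ_self (p + k))
        simp only [← Nat.add_assoc, Nat.succ_eq_add_one] at *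
        omega
    exact (h2 n).trans (ht.monotone h1)

theorem abs_integral_mul_le_sqrt {μ : Measure E} {f g : E → ℝ} (hf : MemLp f 2 μ)
    (hg : MemLp g 2 μ) :
    |∫ x, f x * g x ∂μ| ≤ √(∫ x, f x ^ 2 ∂μ) * √(∫ x, g x ^ 2 ∂μ) := by
  have h1 := integral_mul_norm_le_Lp_mul_Lq (μ := μ) (f := f) (g := g) (p := 2) (q := 2)
    (by constructor <;> norm_num) (by simpa using hf) (by simpa using hg)
  calc |∫ x, f x * g x ∂μ| ≤ ∫ x, ‖f x * g x‖ ∂μ :=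
      norm_integral_le_integral_norm (fun x => f x * g x)
    _ = ∫ x, ‖f x‖ * ‖g x‖ ∂μ := by simp only [norm_mul]
    _ ≤ _ := by
      refine h1.trans (le_of_eq ?_)
      simp [Real.sqrt_eq_rpow]

theorem sqrt_integral_sq_le_of_eLpNorm_le {μ : Measure E} {f : E → ℝ} (hf : MemLp f 2 μ)
    {c : ℝ} (hc : 0 ≤ c) (h : eLpNorm f 2 μ ≤ ENNReal.ofReal c) : √(∫ x, f x ^ 2 ∂μ) ≤ c := by
  rw [hf.eLpNorm_eq_integral_rpow_norm (by norm_num) (by norm_num)] at h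
  refine le_trans (le_of_eq ?_) ((ENNReal.ofReal_le_ofReal_iff hc).1 h)
  simp [Real.sqrt_eq_rpow]

theorem lipOne_sum {l : ℕ} {h φ : ℝ → ℝ} (hh : LipschitzWith 1 h) (hφ : LipschitzWith 1 φ) :
    LipOne l (fun y => φ (∑ i, h (y i))) := by
  intro x y
  have h1 := hφ.dist_le_mul (∑ i, h (x i)) (∑ i, h (y i))
  simp only [Real.dist_eq, NNReal.coe_one, one_mul, ← Finset.sum_sub_distrib] at h1
  refine h1.trans ((Finset.abs_sum_le_sum_abs _ _).trans (Finset.sum_le_sum fun i _ => ?_))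
  simpa [Real.dist_eq] using hh.dist_le_mul (x i) (y i)

theorem memLp_comp_lipschitz {μ : Measure E} [IsFiniteMeasure μ] {p : ℝ≥0∞} {h : ℝ → ℝ}
    (hh : LipschitzWith 1 h) {f : E → ℝ} (hf : MemLp f p μ) : MemLp (fun x => h (f x)) p μ := by
  have h1 : MemLp (fun x => |f x| + |h 0|) p μ := hf.abs.add (memLp_const _)
  refine h1.mono (hh.continuous.comp_aestronglyMeasurable hf.1) (ae_of_all _ fun x => ?_)
  have h2 := hh.dist_le_mul (f x) 0
  simp only [Real.dist_eq, NNReal.coe_one, one_mul, sub_zero] at h2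
  rw [Real.norm_eq_abs, Real.norm_eq_abs, abs_of_nonneg (a := |f x| + |h 0|) (by positivity)]
  have := abs_sub_abs_le_abs_sub (h (f x)) (h 0)
  linarith

theorem memLp_sum_lipschitz {μ : Measure E} [IsFiniteMeasure μ] {p : ℝ≥0∞} {h : ℝ → ℝ}
    (hh : LipschitzWith 1 h) {ζ : ℕ → E → ℝ} (hζ : ∀ i, MemLp (ζ i) p μ) (B : Finset ℕ) :
    MemLp (fun x => ∑ i ∈ B, h (ζ i x)) p μ :=
  memLp_finsetSum B fun i _ => memLp_comp_lipschitz hh (hζ i)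

/-- Since `W` is measurable with respect to the past, `F` may be replaced by its conditional
expectation. Cauchy–Schwarz then leaves the L² distance from that conditional expectation to the
mean, which `theta` bounds by the number of variables times `g n`. -/
theorem covDecay_of_theta {μ : Measure E} [IsProbabilityMeasure μ] {ξ : ℕ → E → ℝ}
    (hξ : ∀ i, Measurable (ξ i)) (hξ2 : ∀ i, MemLp (ξ i) 2 μ) {g : ℕ → ℝ}
    (hg : ∀ n, 1 ≤ n → 0 ≤ g n) (hθ : ∀ n, 1 ≤ n → theta μ ξ n ≤ ENNReal.ofReal (g n)) :
    CovDecay μ ξ g := by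
  intro p n hn B hB h φ hh hφ W hW hW2
  have hF : MemLp (fun x => φ (∑ i ∈ B, h (ξ i x))) 2 μ :=
    memLp_comp_lipschitz hφ (memLp_sum_lipschitz hh hξ2 B)
  set F : E → ℝ := fun x => φ (∑ i ∈ B, h (ξ i x)) with hFdef
  set c := ∫ x, F x ∂μ
  have hm := past_le hξ p
  have hD : MemLp (fun x => (μ[F | past ξ p]) x - c) 2 μ := (hF.condExp (by norm_num)).sub (memLp_const c)
  have hFi : Integrable F μ := hF.integrable (by norm_num)
  have hWi : Integrable W μ := hW2.integrable (by norm_num)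
  have hWF : Integrable (fun x => W x * F x) μ := hW2.integrable_mul hF
  have hWc : Integrable (fun x => W x * (μ[F | past ξ p]) x) μ := hW2.integrable_mul (hF.condExp (by norm_num))
  have e1 : ∫ x, W x * F x ∂μ - (∫ x, W x ∂μ) * c
      = ∫ x, W x * ((μ[F | past ξ p]) x - c) ∂μ := by
    have e2 : ∫ x, W x * F x ∂μ = ∫ x, W x * (μ[F | past ξ p]) x ∂μ := by
      have e3 := condExp_mul_of_stronglyMeasurable_left (μ := μ) (m := past ξ p) (f := W) (g := F)
        hW.stronglyMeasurable hWF hFi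
      rw [← integral_condExp hm (f := fun x => W x * F x)]
      exact integral_congr_ae e3
    simp only [mul_sub]
    rw [integral_sub hWc (hWi.mul_const c), integral_mul_const, e2]
  rw [e1]
  refine (abs_integral_mul_le_sqrt hW2 hD).trans ?_
  refine mul_le_mul_of_nonneg_left ?_ (Real.sqrt_nonneg _)
  have hgn := hg n hn
  -- The coefficients only concern tuples of length at least 1, so the empty set is settled apart.
  rcases B.eq_empty_or_nonempty with rfl | hne
  · have : ∀ x, (μ[F | past ξ p]) x - c = 0 := by
      intro x
      simp [hFdef, c, condExp_const hm]
    simp [this]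
  refine sqrt_integral_sq_le_of_eLpNorm_le hD (by positivity) ?_
  set l := B.card with hl
  have hl1 : 1 ≤ l := hne.card_pos
  set j : Fin l → ℕ := fun i => B.orderEmbOfFin hl.symm i with hj
  have hj1 : StrictMono j := (B.orderEmbOfFin hl.symm).strictMono
  have hj2 : ∀ i, p + n ≤ j i := fun i => hB _ (B.orderEmbOfFin_mem hl.symm i)
  have hsum : ∀ x, ∑ i ∈ B, h (ξ i x) = ∑ i : Fin l, h (ξ (j i) x) := by
    intro x
    have : B = Finset.univ.map (B.orderEmbOfFin hl.symm).toEmbedding := by simp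
    conv_lhs => rw [this]
    rw [Finset.sum_map]
    rfl
  have h1 : eLpNorm (fun x => (μ[F | past ξ p]) x - c) 2 μ
      ≤ theta2 μ (past ξ p) (fun x i => ξ (j i) x) := by
    have := le_iSup₂ (f := fun (f : (Fin l → ℝ) → ℝ) (_ : LipOne l f) =>
      eLpNorm (fun x => (condExp (past ξ p) μ (fun y => f (fun i => ξ (j i) y))) x
        - ∫ y, f (fun i => ξ (j i) y) ∂μ) 2 μ) _ (lipOne_sum hh hφ)
    simp only [← hsum] at this
    exact this
  have h2 : (l : ℝ≥0∞)⁻¹ * theta2 μ (past ξ p) (fun x i => ξ (j i) x) ≤ ENNReal.ofReal (g n) := by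
    refine le_trans ?_ (hθ n hn)
    refine le_trans ?_ (le_iSup₂ (f := fun k (_ : 1 ≤ k) => thetaK μ ξ k n) l hl1)
    refine le_trans ?_ (le_iSup₂ (f := fun (l' : ℕ) (_ : 1 ≤ l' ∧ l' ≤ l) => (l' : ℝ≥0∞)⁻¹ *
      ⨆ (p : ℕ) (j : Fin l' → ℕ) (_ : StrictMono j ∧ ∀ i, p + n ≤ j i),
      theta2 μ (past ξ p) (fun x i => ξ (j i) x)) l ⟨hl1, le_rfl⟩)
    refine mul_le_mul_right ?_ _
    refine le_trans ?_ (le_iSup _ p)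
    exact le_iSup₂ (f := fun (j : Fin l → ℕ) (_ : StrictMono j ∧ ∀ i, p + n ≤ j i) =>
      theta2 μ (past ξ p) (fun x i => ξ (j i) x)) j ⟨hj1, hj2⟩
  refine h1.trans ?_
  rw [ENNReal.ofReal_mul (by positivity), ENNReal.ofReal_natCast]
  have hl0 : (l : ℝ≥0∞) ≠ 0 := by exact_mod_cast (by omega : l ≠ 0)
  rw [mul_comm, ← div_eq_mul_inv, ENNReal.div_le_iff hl0 (by simp)] at h2
  rwa [mul_comm]

end CovDecay

/-! ### Variance bounds and truncation -/

section Variance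

variable {E : Type*} {mE : MeasurableSpace E} {μ : Measure E} [IsProbabilityMeasure μ]
  {ζ : ℕ → E → ℝ} {g : ℕ → ℝ}

/-- Centring `W` leaves the covariance unchanged and turns its L² norm into a standard deviation. -/
theorem CovDecay.abs_cov_past_le (hd : CovDecay μ ζ g)
    (hζ2 : ∀ i, MemLp (ζ i) 2 μ) {p n : ℕ} (hn : 1 ≤ n) {B : Finset ℕ} (hB : ∀ i ∈ B, p + n ≤ i)
    {h : ℝ → ℝ} (hh : LipschitzWith 1 h) {W : E → ℝ} (hW : Measurable[past ζ p] W)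
    (hW2 : MemLp W 2 μ) :
    |cov[W, fun x => ∑ i ∈ B, h (ζ i x); μ]| ≤ √(variance W μ) * (B.card * g n) := by
  have hV : MemLp (fun x => ∑ i ∈ B, h (ζ i x)) 2 μ := memLp_sum_lipschitz hh hζ2 B
  have hWc : MemLp (fun x => W x - ∫ y, W y ∂μ) 2 μ := hW2.sub (memLp_const _)
  rw [← covariance_sub_const_left (hW2.integrable (by norm_num)) (∫ y, W y ∂μ),
    covariance_eq_sub hWc hV, variance_eq_integral hW2.aemeasurable]
  have := hd p n hn B hB h id hh LipschitzWith.id _ (hW.sub_const (∫ y, W y ∂μ)) hWc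
  simpa using this

theorem CovDecay.abs_cov_le (hd : CovDecay μ ζ g) (hζ2 : ∀ i, MemLp (ζ i) 2 μ)
    {h : ℝ → ℝ} (hh : LipschitzWith 1 h) {i j : ℕ} (hij : i < j) :
    |cov[fun x => h (ζ i x), fun x => h (ζ j x); μ]| ≤
      √(∫ x, h (ζ i x) ^ 2 ∂μ) * g (j - i) := by
  have hWi := memLp_comp_lipschitz hh (hζ2 i)
  rw [covariance_eq_sub hWi (memLp_comp_lipschitz hh (hζ2 j))]
  have := hd i (j - i) (by omega) {j} (by simp; omega) h id hh LipschitzWith.id _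
    (hh.continuous.measurable.comp (measurable_past le_rfl)) hWi
  simpa using this

/-- Each positive distance to `i` occurs at most twice, once on either side. -/
theorem sum_dist_le_tsum (hg : ∀ k, 0 ≤ g k) (hs : Summable g) (I : Finset ℕ) (i : ℕ) :
    ∑ j ∈ I with j ≠ i, g (max i j - min i j) ≤ 2 * ∑' k, g k := by
  have h1 : ∀ f : ℕ → ℕ, ∀ J : Finset ℕ, Set.InjOn f J → ∑ j ∈ J, g (f j) ≤ ∑' k, g k := by
    intro f J hf
    rw [← Finset.sum_image (f := g) hf]
    exact hs.sum_le_tsum _ fun k _ => hg k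
  have h2 : (I.filter (· ≠ i)) = (I.filter (· < i)) ∪ (I.filter (i < ·)) := by
    ext j; simp only [Finset.mem_filter, Finset.mem_union, ne_iff_lt_or_gt, and_or_left]
  rw [h2]
  have h3 := h1 (fun j => max i j - min i j) (I.filter (· < i)) (by
    intro a ha b hb hab
    simp only [Finset.coe_filter, Set.mem_ofPred_eq] at ha hb hab
    omega)
  have h4 := h1 (fun j => max i j - min i j) (I.filter (i < ·)) (by
    intro a ha b hb hab
    simp only [Finset.coe_filter, Set.mem_ofPred_eq] at ha hb hab
    omega)
  rw [Finset.sum_union]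
  · linarith
  · rw [Finset.disjoint_left]
    intro a ha hb
    simp only [Finset.mem_filter] at ha hb
    omega

/-- Every row of the covariance matrix has a diagonal term at most `K ^ 2` and off-diagonal terms at
most `K * g |i - j|`, so the variance grows at most linearly. It serves for `h` the identity, the
truncation, and the truncation remainder, for which `K` can be made small. -/
theorem CovDecay.variance_sum_le (hd : CovDecay μ ζ g) (hζ2 : ∀ i, MemLp (ζ i) 2 μ)
    (hg : ∀ k, 0 ≤ g k) (hs : Summable g) {h : ℝ → ℝ} (hh : LipschitzWith 1 h) {K : ℝ}
    (hK : ∀ i, √(∫ x, h (ζ i x) ^ 2 ∂μ) ≤ K) (I : Finset ℕ) :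
    variance (fun x => ∑ i ∈ I, h (ζ i x)) μ ≤ I.card * (K ^ 2 + 2 * K * ∑' k, g k) := by
  have hK0 : 0 ≤ K := (Real.sqrt_nonneg _).trans (hK 0)
  have hm : ∀ i, MemLp (fun x => h (ζ i x)) 2 μ := fun i => memLp_comp_lipschitz hh (hζ2 i)
  rw [variance_fun_sum' (fun i _ => hm i)]
  have hcov : ∀ i j, i ≠ j →
      cov[fun x => h (ζ i x), fun x => h (ζ j x); μ] ≤ K * g (max i j - min i j) := by
    intro i j hij
    rcases lt_or_gt_of_ne hij with hlt | hlt
    · refine (le_abs_self _).trans ((hd.abs_cov_le hζ2 hh hlt).trans ?_)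
      rw [max_eq_right hlt.le, min_eq_left hlt.le]
      exact mul_le_mul_of_nonneg_right (hK i) (hg _)
    · rw [covariance_comm]
      refine (le_abs_self _).trans ((hd.abs_cov_le hζ2 hh hlt).trans ?_)
      rw [max_eq_left hlt.le, min_eq_right hlt.le]
      exact mul_le_mul_of_nonneg_right (hK j) (hg _)
  rw [← nsmul_eq_mul]
  refine Finset.sum_le_card_nsmul I _ _ fun i hi => ?_
  rw [← Finset.sum_filter_add_sum_filter_not I (· = i), Finset.filter_eq' I i, if_pos hi,
    Finset.sum_singleton, covariance_self (hm i).aemeasurable]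
  refine add_le_add ?_ ?_
  · refine (variance_le_expectation_sq (hm i).1).trans ?_
    exact (Real.sqrt_le_left hK0).1 (hK i)
  · calc ∑ j ∈ I with ¬ j = i, cov[fun x => h (ζ i x), fun x => h (ζ j x); μ]
        ≤ ∑ j ∈ I with j ≠ i, K * g (max i j - min i j) :=
          Finset.sum_le_sum fun j hj => hcov i j (Ne.symm (Finset.mem_filter.1 hj).2)
      _ = K * ∑ j ∈ I with j ≠ i, g (max i j - min i j) := by rw [Finset.mul_sum]
      _ ≤ K * (2 * ∑' k, g k) := mul_le_mul_of_nonneg_left (sum_dist_le_tsum hg hs I i) hK0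
      _ = _ := by ring

theorem abs_covariance_le_sqrt {X Y : E → ℝ} (hX : MemLp X 2 μ) (hY : MemLp Y 2 μ) :
    |cov[X, Y; μ]| ≤ √(variance X μ) * √(variance Y μ) := by
  rw [variance_eq_integral hX.aemeasurable, variance_eq_integral hY.aemeasurable]
  exact abs_integral_mul_le_sqrt (hX.sub (memLp_const _)) (hY.sub (memLp_const _))

theorem sqrt_variance_add_le {X Y : E → ℝ} (hX : MemLp X 2 μ) (hY : MemLp Y 2 μ) :
    √(variance (fun x => X x + Y x) μ) ≤ √(variance X μ) + √(variance Y μ) := by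
  refine Real.sqrt_le_left (by positivity) |>.2 ?_
  rw [variance_fun_add hX hY]
  have h1 := (le_abs_self _).trans (abs_covariance_le_sqrt hX hY)
  have h2 := Real.sq_sqrt (variance_nonneg X μ)
  have h3 := Real.sq_sqrt (variance_nonneg Y μ)
  nlinarith

theorem abs_variance_add_sub_le {X Y : E → ℝ} (hX : MemLp X 2 μ) (hY : MemLp Y 2 μ) :
    |variance (fun x => X x + Y x) μ - variance X μ| ≤
      √(variance Y μ) * (2 * √(variance X μ) + √(variance Y μ)) := by
  rw [variance_fun_add hX hY]
  have h1 := abs_covariance_le_sqrt hX hY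
  have h3 := Real.mul_self_sqrt (variance_nonneg Y μ)
  rw [abs_le] at h1 ⊢
  constructor <;> nlinarith [variance_nonneg Y μ]

/-- Truncation of a real number at level `T`. -/
def clamp (T x : ℝ) : ℝ := max (-T) (min T x)

theorem lipschitz_clamp (T : ℝ) : LipschitzWith 1 (clamp T) :=
  (LipschitzWith.id.const_min T).const_max (-T)

theorem lipschitz_sub_clamp {T : ℝ} (hT : 0 ≤ T) : LipschitzWith 1 (fun x => x - clamp T x) := by
  refine LipschitzWith.of_dist_le_mul fun x y => ?_
  simp only [Real.dist_eq, NNReal.coe_one, one_mul, clamp]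
  rcases le_total T x with h1 | h1 <;> rcases le_total T y with h2 | h2 <;>
  rcases le_total (-T) x with h3 | h3 <;> rcases le_total (-T) y with h4 | h4 <;>
  simp only [min_eq_left, min_eq_right, max_eq_left, max_eq_right, h1, h2, h3, h4,
    (by linarith : -T ≤ T)] <;>
  rw [abs_le] <;> constructor <;>
  linarith [le_abs_self (x - y), neg_abs_le (x - y)]

theorem abs_clamp_le {T : ℝ} (hT : 0 ≤ T) (x : ℝ) : |clamp T x| ≤ T := by
  rw [clamp, abs_le]
  exact ⟨le_max_left _ _, max_le (by linarith) (min_le_left _ _)⟩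

theorem clamp_eq_self {T x : ℝ} (hx : |x| ≤ T) : clamp T x = x := by
  rw [abs_le] at hx
  rw [clamp, min_eq_right hx.2, max_eq_right hx.1]

theorem abs_clamp_le_abs {T : ℝ} (hT : 0 ≤ T) (x : ℝ) : |clamp T x| ≤ |x| := by
  have := (lipschitz_clamp T).dist_le_mul x 0
  simpa [Real.dist_eq, clamp_eq_self (T := T) (x := 0) (by simpa)] using this

theorem abs_sub_clamp_le_abs {T : ℝ} (hT : 0 ≤ T) (x : ℝ) : |x - clamp T x| ≤ |x| := by
  have := (lipschitz_sub_clamp hT).dist_le_mul x 0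
  simpa [Real.dist_eq, clamp_eq_self (T := T) (x := 0) (by simpa)] using this

/-- With `T = √C`, the remainder vanishes where `ζ i ^ 2 ≤ C` and is at most `|ζ i|` elsewhere,
which is the tail controlled by uniform integrability. -/
theorem exists_sqrt_integral_sub_clamp_le (hζ2 : ∀ i, MemLp (ζ i) 2 μ)
    (hui : UniformIntegrable (fun i x => (ζ i x) ^ 2) 1 μ) {δ : ℝ} (hδ : 0 < δ) :
    ∃ T : ℝ, 0 ≤ T ∧ ∀ i, √(∫ x, (ζ i x - clamp T (ζ i x)) ^ 2 ∂μ) ≤ δ := by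
  obtain ⟨C, hC⟩ := hui.spec one_ne_zero ENNReal.one_ne_top (sq_pos_of_pos hδ)
  refine ⟨√C, Real.sqrt_nonneg _, fun i => ?_⟩
  have hT : 0 ≤ √(C : ℝ) := Real.sqrt_nonneg _
  refine (Real.sqrt_le_left hδ.le).2 ?_
  have h1 := hC i
  have hm : MemLp (fun x => ζ i x - clamp √C (ζ i x)) 2 μ :=
    memLp_comp_lipschitz (lipschitz_sub_clamp hT) (hζ2 i)
  rw [integral_eq_lintegral_of_nonneg_ae (ae_of_all _ fun x => sq_nonneg _)
    hm.integrable_sq.aestronglyMeasurable]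
  refine ENNReal.toReal_le_of_le_ofReal (by positivity) (le_trans ?_ h1)
  rw [eLpNorm_one_eq_lintegral_enorm]
  refine lintegral_mono fun x => ?_
  by_cases hx : |ζ i x| ≤ √C
  · simp [clamp_eq_self hx]
  · push Not at hx
    have hmem : x ∈ {x | C ≤ ‖ζ i x ^ 2‖₊} := by
      simp only [Set.mem_ofPred_eq, ← NNReal.coe_le_coe, coe_nnnorm, Real.norm_eq_abs, abs_pow]
      have := Real.sq_sqrt C.coe_nonneg
      nlinarith
    rw [Set.indicator_of_mem hmem, Real.enorm_of_nonneg (sq_nonneg _)]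
    exact ENNReal.ofReal_le_ofReal (sq_le_sq.2 (abs_sub_clamp_le_abs hT _))

end Variance

/-! ### Estimates on characteristic functions -/

section CharFun

variable {E : Type*} {mE : MeasurableSpace E} {μ : Measure E} [IsProbabilityMeasure μ]

theorem integrable_of_abs_le_one {f : E → ℝ} (hf : AEMeasurable f μ) (h : ∀ x, |f x| ≤ 1) :
    Integrable f μ :=
  Integrable.of_bound hf.aestronglyMeasurable 1 (ae_of_all _ h)

theorem integrable_cexp {X : E → ℝ} (hX : AEMeasurable X μ) :
    Integrable (fun x => Complex.exp (X x * Complex.I)) μ :=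
  Integrable.of_bound (by fun_prop) 1
    (ae_of_all _ fun x => (Complex.norm_exp_ofReal_mul_I _).le)

theorem norm_integral_cexp_le (X : E → ℝ) :
    ‖∫ x, Complex.exp (X x * Complex.I) ∂μ‖ ≤ 1 := by
  refine (norm_integral_le_of_norm_le_const (C := 1)
    (ae_of_all _ fun x => (Complex.norm_exp_ofReal_mul_I _).le)).trans ?_
  simp

theorem integral_cexp {X : E → ℝ} (hX : AEMeasurable X μ) :
    ∫ x, Complex.exp (X x * Complex.I) ∂μ
      = ((∫ x, Real.cos (X x) ∂μ : ℝ) : ℂ) + ((∫ x, Real.sin (X x) ∂μ : ℝ) : ℂ) * Complex.I := by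
  have hc : Integrable (fun x => Real.cos (X x)) μ :=
    integrable_of_abs_le_one (by fun_prop) fun x => Real.abs_cos_le_one _
  have hs : Integrable (fun x => Real.sin (X x)) μ :=
    integrable_of_abs_le_one (by fun_prop) fun x => Real.abs_sin_le_one _
  rw [← integral_complex_ofReal, ← integral_complex_ofReal, ← integral_mul_const, ← integral_add hc.ofReal
    (hs.ofReal.mul_const _)]
  refine integral_congr_ae (ae_of_all _ fun x => ?_)
  simp [Complex.exp_mul_I]

/-- The dependence inequality speaks of real functions, so the exponential is split into sines and
cosines; the real and imaginary parts of the defect contain two covariances each, whence the factor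
4. -/
theorem norm_integral_cexp_add_sub_le {A V : E → ℝ} (hA : AEMeasurable A μ) (hV : AEMeasurable V μ)
    {ρ : ℝ}
    (hcc : |∫ x, Real.cos (A x) * Real.cos (V x) ∂μ
      - (∫ x, Real.cos (A x) ∂μ) * ∫ x, Real.cos (V x) ∂μ| ≤ ρ)
    (hss : |∫ x, Real.sin (A x) * Real.sin (V x) ∂μ
      - (∫ x, Real.sin (A x) ∂μ) * ∫ x, Real.sin (V x) ∂μ| ≤ ρ)
    (hcs : |∫ x, Real.cos (A x) * Real.sin (V x) ∂μ
      - (∫ x, Real.cos (A x) ∂μ) * ∫ x, Real.sin (V x) ∂μ| ≤ ρ)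
    (hsc : |∫ x, Real.sin (A x) * Real.cos (V x) ∂μ
      - (∫ x, Real.sin (A x) ∂μ) * ∫ x, Real.cos (V x) ∂μ| ≤ ρ) :
    ‖∫ x, Complex.exp ((A x + V x : ℝ) * Complex.I) ∂μ
      - (∫ x, Complex.exp (A x * Complex.I) ∂μ) * ∫ x, Complex.exp (V x * Complex.I) ∂μ‖
      ≤ 4 * ρ := by
  have hb : ∀ a b : ℝ, |Real.cos a * Real.cos b| ≤ 1 ∧ |Real.sin a * Real.sin b| ≤ 1 ∧
      |Real.cos a * Real.sin b| ≤ 1 ∧ |Real.sin a * Real.cos b| ≤ 1 := by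
    intro a b
    simp only [abs_mul]
    refine ⟨?_, ?_, ?_, ?_⟩ <;>
    exact mul_le_one₀ (by first | exact Real.abs_cos_le_one _ | exact Real.abs_sin_le_one _)
      (abs_nonneg _) (by first | exact Real.abs_cos_le_one _ | exact Real.abs_sin_le_one _)
  have icc : Integrable (fun x => Real.cos (A x) * Real.cos (V x)) μ :=
    integrable_of_abs_le_one (by fun_prop) fun x => (hb _ _).1
  have iss : Integrable (fun x => Real.sin (A x) * Real.sin (V x)) μ :=
    integrable_of_abs_le_one (by fun_prop) fun x => (hb _ _).2.1
  have ics : Integrable (fun x => Real.cos (A x) * Real.sin (V x)) μ :=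
    integrable_of_abs_le_one (by fun_prop) fun x => (hb _ _).2.2.1
  have isc : Integrable (fun x => Real.sin (A x) * Real.cos (V x)) μ :=
    integrable_of_abs_le_one (by fun_prop) fun x => (hb _ _).2.2.2
  rw [integral_cexp hA, integral_cexp hV, integral_cexp (X := fun x => A x + V x) (by fun_prop)]
  simp only [Real.cos_add, Real.sin_add]
  rw [integral_sub icc iss, integral_add isc ics]
  set cc := ∫ x, Real.cos (A x) * Real.cos (V x) ∂μ
  set ss := ∫ x, Real.sin (A x) * Real.sin (V x) ∂μ
  set cs := ∫ x, Real.cos (A x) * Real.sin (V x) ∂μ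
  set sc := ∫ x, Real.sin (A x) * Real.cos (V x) ∂μ
  set c := ∫ x, Real.cos (A x) ∂μ
  set s := ∫ x, Real.sin (A x) ∂μ
  set c' := ∫ x, Real.cos (V x) ∂μ
  set s' := ∫ x, Real.sin (V x) ∂μ
  have e : (((cc - ss : ℝ) : ℂ) + ((sc + cs : ℝ) : ℂ) * Complex.I)
      - ((c : ℂ) + s * Complex.I) * ((c' : ℂ) + s' * Complex.I)
      = (((cc - c * c') - (ss - s * s') : ℝ) : ℂ)
        + (((sc - s * c') + (cs - c * s') : ℝ) : ℂ) * Complex.I := by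
    push_cast
    linear_combination (-(s : ℂ) * s') * Complex.I_sq
  rw [e]
  refine (norm_add_le _ _).trans ?_
  rw [norm_mul, Complex.norm_I, mul_one, Complex.norm_real, Complex.norm_real, Real.norm_eq_abs,
    Real.norm_eq_abs]
  have h1 := abs_sub (cc - c * c') (ss - s * s')
  have h2 := abs_add_le (sc - s * c') (cs - c * s')
  linarith

/-- The price of discarding a part `Y` that is small in L², from `|exp (i y) - 1| ≤ |y|`. -/
theorem norm_integral_cexp_sub_le {X Y : E → ℝ} (hX : MemLp X 2 μ) (hY : MemLp Y 2 μ) :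
    ‖∫ x, Complex.exp ((X x + Y x : ℝ) * Complex.I) ∂μ - ∫ x, Complex.exp (X x * Complex.I) ∂μ‖
      ≤ √(∫ x, Y x ^ 2 ∂μ) := by
  have hYi := hY.integrable (by norm_num)
  rw [← integral_sub (integrable_cexp (X := fun x => X x + Y x) (hX.add hY).aemeasurable)
    (integrable_cexp hX.aemeasurable)]
  refine (norm_integral_le_integral_norm _).trans ?_
  have h1 : ∫ x, ‖Complex.exp ((X x + Y x : ℝ) * Complex.I) - Complex.exp (X x * Complex.I)‖ ∂μ
      ≤ ∫ x, |Y x| ∂μ := by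
    refine integral_mono_of_nonneg (ae_of_all _ fun x => norm_nonneg _) hYi.abs
      (ae_of_all _ fun x => ?_)
    have e : Complex.exp ((X x + Y x : ℝ) * Complex.I) - Complex.exp (X x * Complex.I)
        = Complex.exp (X x * Complex.I) * (Complex.exp (Complex.I * Y x) - 1) := by
      rw [mul_sub, ← Complex.exp_add, mul_one]
      congr 2
      push_cast; ring
    simp only [e]
    rw [norm_mul, Complex.norm_exp_ofReal_mul_I, one_mul]
    exact Real.norm_exp_I_mul_ofReal_sub_one_le
  refine h1.trans ?_
  have h2 := abs_integral_mul_le_sqrt (μ := μ) (f := fun x => |Y x|) (g := fun _ => 1) hY.abs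
    (memLp_const 1)
  simp only [mul_one, sq_abs] at h2
  refine (le_abs_self _).trans (h2.trans (le_of_eq ?_))
  simp

theorem norm_cexp_sub_taylor_le {y : ℝ} (hy : |y| ≤ 1) :
    ‖Complex.exp (y * Complex.I) - (1 + y * Complex.I - (y : ℂ) ^ 2 / 2)‖ ≤ |y| ^ 3 := by
  have hn : ‖(y : ℂ) * Complex.I‖ = |y| := by simp
  have h := Complex.exp_bound (x := y * Complex.I) (by rw [hn]; exact hy) (n := 3) (by norm_num)
  rw [hn] at h
  have e : ∑ m ∈ Finset.range 3, (y * Complex.I) ^ m / (m.factorial : ℂ)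
      = 1 + y * Complex.I - (y : ℂ) ^ 2 / 2 := by
    simp only [Finset.sum_range_succ, Finset.sum_range_zero, Nat.factorial]
    push_cast
    linear_combination ((y : ℂ) ^ 2 / 2) * Complex.I_sq
  rw [e] at h
  refine h.trans ?_
  have : 0 ≤ |y| ^ 3 := by positivity
  norm_num [Nat.factorial]
  linarith

/-- Comparison of the characteristic function of a small centered variable with the Gaussian one. -/
theorem norm_integral_cexp_sub_gaussian_le {D : E → ℝ} (hD : AEMeasurable D μ) {M v : ℝ}
    (hM : ∀ x, |D x| ≤ M) (hvM : |v| * M ≤ 1) (h0 : ∫ x, D x ∂μ = 0) :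
    ‖∫ x, Complex.exp ((v * D x : ℝ) * Complex.I) ∂μ
      - (Real.exp (-(v ^ 2 * variance D μ / 2)) : ℝ)‖ ≤ 2 * |v| ^ 3 * M * variance D μ := by
  obtain ⟨x0⟩ : Nonempty E := μ.nonempty_of_neZero
  have hM0 : 0 ≤ M := (abs_nonneg _).trans (hM x0)
  have hDi : Integrable D μ := Integrable.of_bound hD.aestronglyMeasurable M (ae_of_all _ hM)
  have hsq : ∀ x, D x ^ 2 ≤ M ^ 2 := fun x => sq_le_sq' (by linarith [(abs_le.1 (hM x)).1])
    (abs_le.1 (hM x)).2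
  have hD2 : Integrable (fun x => D x ^ 2) μ := by
    refine Integrable.of_bound (by fun_prop) (M ^ 2) (ae_of_all _ fun x => ?_)
    simpa using hsq x
  have hvar : variance D μ = ∫ x, D x ^ 2 ∂μ := variance_of_integral_eq_zero hD h0
  rw [hvar]
  set s := ∫ x, D x ^ 2 ∂μ with hs
  have hs0 : 0 ≤ s := integral_nonneg fun x => sq_nonneg _
  have hsM : s ≤ M ^ 2 := by
    have := integral_mono hD2 (integrable_const (M ^ 2)) hsq
    simpa using this
  have hvM2 : v ^ 2 * M ^ 2 ≤ |v| * M := by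
    have h1 : v ^ 2 * M ^ 2 = (|v| * M) * (|v| * M) := by rw [← sq_abs v]; ring
    rw [h1]
    exact mul_le_of_le_one_right (by positivity) hvM
  have e1 : ∫ x, (1 + ((v * D x : ℝ) : ℂ) * Complex.I - ((v * D x : ℝ) : ℂ) ^ 2 / 2) ∂μ
      = ((1 - v ^ 2 * s / 2 : ℝ) : ℂ) := by
    have i1 : Integrable (fun x => ((v * D x : ℝ) : ℂ) * Complex.I) μ :=
      (hDi.const_mul v).ofReal.mul_const _
    have i2 : Integrable (fun x => ((v ^ 2 * D x ^ 2 / 2 : ℝ) : ℂ)) μ :=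
      ((hD2.const_mul (v ^ 2)).div_const 2).ofReal
    have e2 : ∀ x, ((v * D x : ℝ) : ℂ) ^ 2 / 2 = ((v ^ 2 * D x ^ 2 / 2 : ℝ) : ℂ) := by
      intro x; push_cast; ring
    simp only [e2]
    have i0 : Integrable (fun x => (1 : ℂ) + ((v * D x : ℝ) : ℂ) * Complex.I) μ :=
      (integrable_const _).add i1
    rw [integral_sub i0 i2, integral_add (integrable_const _) i1,
      integral_mul_const, integral_complex_ofReal, integral_complex_ofReal, integral_const_mul, h0,
      integral_div, integral_const_mul]
    simp [hs]
  -- One factor `|D|` of the cubic Taylor error is bounded by `M`; the other two integrate to the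
  -- variance.
  have hT : ‖∫ x, Complex.exp ((v * D x : ℝ) * Complex.I) ∂μ - ((1 - v ^ 2 * s / 2 : ℝ) : ℂ)‖
      ≤ |v| ^ 3 * M * s := by
    rw [← e1, ← integral_sub (integrable_cexp (X := fun x => v * D x) (by fun_prop))]
    · refine (norm_integral_le_integral_norm _).trans ?_
      have : ∫ x, |v| ^ 3 * M * D x ^ 2 ∂μ = |v| ^ 3 * M * s := integral_const_mul _ _
      rw [← this]
      refine integral_mono_of_nonneg (ae_of_all _ fun x => norm_nonneg _) (hD2.const_mul _)
        (ae_of_all _ fun x => ?_)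
      have hle : |v * D x| ≤ 1 := by
        rw [abs_mul]
        exact (mul_le_mul_of_nonneg_left (hM x) (abs_nonneg v)).trans hvM
      refine (norm_cexp_sub_taylor_le hle).trans ?_
      have : |v * D x| ^ 3 = |v| ^ 3 * |D x| * D x ^ 2 := by
        rw [abs_mul, ← sq_abs (D x)]; ring
      rw [this]
      exact mul_le_mul_of_nonneg_right (mul_le_mul_of_nonneg_left (hM x) (by positivity))
        (sq_nonneg _)
    · have i1 : Integrable (fun x => ((v * D x : ℝ) : ℂ) * Complex.I) μ :=
        (hDi.const_mul v).ofReal.mul_const _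
      have i2 : Integrable (fun x => ((v ^ 2 * D x ^ 2 / 2 : ℝ) : ℂ)) μ :=
        ((hD2.const_mul (v ^ 2)).div_const 2).ofReal
      refine (((integrable_const (1 : ℂ)).add i1).sub i2).congr (ae_of_all _ fun x => ?_)
      simp
      ring
  set y := v ^ 2 * s / 2 with hy
  have hy0 : 0 ≤ y := by positivity
  have hyM : y ≤ |v| * M := by
    have : v ^ 2 * s ≤ v ^ 2 * M ^ 2 := mul_le_mul_of_nonneg_left hsM (sq_nonneg v)
    rw [hy]
    nlinarith [mul_nonneg (abs_nonneg v) hM0]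
  -- The error is of order `y ^ 2`, and `y ≤ |v| * M` puts it in the same form as the Taylor error.
  -- These two contributions account for the constant 2.
  have hexp : |(1 - y) - Real.exp (-y)| ≤ |v| ^ 3 * M * s := by
    have h1 := Real.abs_exp_sub_one_sub_id_le (x := -y) (by rw [abs_neg, abs_of_nonneg hy0]; linarith)
    rw [abs_sub_comm]
    have e3 : Real.exp (-y) - (1 - y) = Real.exp (-y) - 1 - -y := by ring
    rw [e3]
    refine h1.trans ?_
    calc (-y) ^ 2 = y * y := by ring
      _ ≤ y * (|v| * M) := mul_le_mul_of_nonneg_left hyM hy0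
      _ = |v| ^ 3 * M * s / 2 := by rw [hy, ← sq_abs v]; ring
      _ ≤ _ := by
        have : 0 ≤ |v| ^ 3 * M * s := by positivity
        linarith
  have h4 : ‖((1 - y : ℝ) : ℂ) - (Real.exp (-y) : ℝ)‖ ≤ |v| ^ 3 * M * s := by
    rw [← Complex.ofReal_sub, Complex.norm_real]
    exact hexp
  have h5 := norm_sub_le_norm_sub_add_norm_sub
    (∫ x, Complex.exp ((v * D x : ℝ) * Complex.I) ∂μ) ((1 - y : ℝ) : ℂ) ((Real.exp (-y) : ℝ) : ℂ)
  linarith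

end CharFun

/-! ### Bernstein blocks -/

section Blocks

/-- The `b`-th big block: `p` consecutive indices, preceded by a gap of `q` indices. -/
def block (p q b : ℕ) : Finset ℕ := Finset.Ico (b * (q + p) + q) ((b + 1) * (q + p))

/-- The union of the first `k` big blocks. -/
def blocks (p q k : ℕ) : Finset ℕ := (Finset.range k).biUnion (block p q)

theorem card_block (p q b : ℕ) : (block p q b).card = p := by
  rw [block, Nat.card_Ico, Nat.succ_mul]; omega

theorem blocks_succ (p q k : ℕ) : blocks p q (k + 1) = blocks p q k ∪ block p q k := by
  rw [blocks, Finset.range_add_one, Finset.biUnion_insert, Finset.union_comm, blocks]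

theorem lt_of_mem_blocks {p q k i : ℕ} (h : i ∈ blocks p q k) : i < k * (q + p) := by
  obtain ⟨b, hb, hi⟩ := Finset.mem_biUnion.1 h
  rw [Finset.mem_range] at hb
  exact (Finset.mem_Ico.1 hi).2.trans_le (Nat.mul_le_mul_right _ hb)

theorem le_of_mem_block {p q b i : ℕ} (h : i ∈ block p q b) : b * (q + p) + q ≤ i :=
  (Finset.mem_Ico.1 h).1

theorem disjoint_blocks_block (p q k : ℕ) : Disjoint (blocks p q k) (block p q k) := by
  rw [Finset.disjoint_left]
  intro i h1 h2
  have := lt_of_mem_blocks h1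
  have := le_of_mem_block h2
  omega

theorem card_blocks (p q k : ℕ) : (blocks p q k).card = k * p := by
  induction k with
  | zero => simp [blocks]
  | succ k ih =>
    rw [blocks_succ, Finset.card_union_of_disjoint (disjoint_blocks_block p q k), ih, card_block,
      Nat.succ_mul]

theorem sum_blocks_succ (p q k : ℕ) (f : ℕ → ℝ) :
    ∑ i ∈ blocks p q (k + 1), f i = ∑ i ∈ blocks p q k, f i + ∑ i ∈ block p q k, f i := by
  rw [blocks_succ, Finset.sum_union (disjoint_blocks_block p q k)]

variable {E : Type*} {mE : MeasurableSpace E} {μ : Measure E} [IsProbabilityMeasure μ]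
  {ζ : ℕ → E → ℝ} {g : ℕ → ℝ}

theorem measurable_past_blocks {h : ℝ → ℝ} (hh : LipschitzWith 1 h) (p q k : ℕ) :
    Measurable[past ζ (k * (q + p))] (fun x => ∑ i ∈ blocks p q k, h (ζ i x)) :=
  Finset.measurable_fun_sum _ fun _ hi =>
    hh.continuous.measurable.comp (measurable_past (lt_of_mem_blocks hi).le)

/-- Scaling `φ` by `L⁻¹` makes it 1-Lipschitz, and a variable bounded by 1 has L² norm at most 1. -/
theorem CovDecay.abs_cov_bounded_le (hd : CovDecay μ ζ g) (hζ : ∀ i, Measurable (ζ i))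
    (hg : ∀ k, 0 ≤ g k) {p n : ℕ} (hn : 1 ≤ n)
    {B : Finset ℕ} (hB : ∀ i ∈ B, p + n ≤ i) {h φ : ℝ → ℝ} (hh : LipschitzWith 1 h) {L : ℝ}
    (hL : 0 < L) (hφ : ∀ a b, |φ a - φ b| ≤ L * |a - b|) {W : E → ℝ}
    (hW : Measurable[past ζ p] W) (hW1 : ∀ x, |W x| ≤ 1) :
    |∫ x, W x * φ (∑ i ∈ B, h (ζ i x)) ∂μ - (∫ x, W x ∂μ) * ∫ x, φ (∑ i ∈ B, h (ζ i x)) ∂μ|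
      ≤ L * (B.card * g n) := by
  have hφ' : LipschitzWith 1 (fun s => L⁻¹ * φ s) := by
    refine LipschitzWith.of_dist_le_mul fun a b => ?_
    simp only [Real.dist_eq, NNReal.coe_one, one_mul, ← mul_sub]
    rw [abs_mul, abs_of_pos (inv_pos.2 hL), inv_mul_le_iff₀ hL]
    exact hφ a b
  have hWm : Measurable W := hW.mono (past_le hζ p) le_rfl
  have hW2 : MemLp W 2 μ := MemLp.of_bound hWm.aestronglyMeasurable 1 (ae_of_all _ hW1)
  have key := hd p n hn B hB h _ hh hφ' W hW hW2
  have e1 : ∀ x, W x * (L⁻¹ * φ (∑ i ∈ B, h (ζ i x))) = L⁻¹ * (W x * φ (∑ i ∈ B, h (ζ i x))) :=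
    fun x => by ring
  simp only [e1] at key
  rw [integral_const_mul, integral_const_mul, mul_left_comm, ← mul_sub, abs_mul,
    abs_of_pos (inv_pos.2 hL), inv_mul_le_iff₀ hL] at key
  refine key.trans (mul_le_mul_of_nonneg_left ?_ hL.le)
  have hs : √(∫ x, W x ^ 2 ∂μ) ≤ 1 := by
    refine (Real.sqrt_le_left zero_le_one).2 ?_
    have := integral_mono hW2.integrable_sq (integrable_const (1 : ℝ)) (fun x => by
      have := abs_le.1 (hW1 x)
      show W x ^ 2 ≤ 1
      nlinarith)
    simpa using this
  exact mul_le_of_le_one_left (mul_nonneg (Nat.cast_nonneg _) (hg n)) hs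

/-- The first `k` blocks are measurable with respect to the past at time `k * (q + p)`, and the next
block starts `q` later. The sine and cosine of `v * (s - c)` are `|v|`-Lipschitz in `s`. -/
theorem CovDecay.norm_integral_cexp_blocks_succ_le (hd : CovDecay μ ζ g)
    (hζ : ∀ i, Measurable (ζ i)) (hg : ∀ k, 0 ≤ g k)
    {h : ℝ → ℝ} (hh : LipschitzWith 1 h) {p q : ℕ} (hq : 1 ≤ q) {v : ℝ} (hv : v ≠ 0)
    (k : ℕ) (a c : ℝ) :
    ‖∫ x, Complex.exp ((v * (∑ i ∈ blocks p q k, h (ζ i x) - a)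
        + v * (∑ i ∈ block p q k, h (ζ i x) - c) : ℝ) * Complex.I) ∂μ
      - (∫ x, Complex.exp ((v * (∑ i ∈ blocks p q k, h (ζ i x) - a) : ℝ) * Complex.I) ∂μ)
      * ∫ x, Complex.exp ((v * (∑ i ∈ block p q k, h (ζ i x) - c) : ℝ) * Complex.I) ∂μ‖
      ≤ 4 * (|v| * (p * g q)) := by
  have hm : ∀ B : Finset ℕ, Measurable (fun x => ∑ i ∈ B, h (ζ i x)) := fun B =>
    Finset.measurable_fun_sum _ fun i _ => hh.continuous.measurable.comp (hζ i)
  have hA := measurable_past_blocks (ζ := ζ) hh p q k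
  have hA' : Measurable[past ζ (k * (q + p))]
      (fun x => v * (∑ i ∈ blocks p q k, h (ζ i x) - a)) := (hA.sub_const a).const_mul v
  have hcos : ∀ s t, |Real.cos (v * (s - c)) - Real.cos (v * (t - c))| ≤ |v| * |s - t| := by
    intro s t
    refine (Real.abs_cos_sub_cos_le _ _).trans (le_of_eq ?_)
    rw [← abs_mul]; congr 1; ring
  have hsin : ∀ s t, |Real.sin (v * (s - c)) - Real.sin (v * (t - c))| ≤ |v| * |s - t| := by
    intro s t
    refine (Real.abs_sin_sub_sin_le _ _).trans (le_of_eq ?_)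
    rw [← abs_mul]; congr 1; ring
  have key : ∀ φ ψ : ℝ → ℝ, Measurable ψ → (∀ s, |ψ s| ≤ 1) →
      (∀ s t, |φ (v * (s - c)) - φ (v * (t - c))| ≤ |v| * |s - t|) →
      |∫ x, ψ (v * (∑ i ∈ blocks p q k, h (ζ i x) - a))
        * φ (v * (∑ i ∈ block p q k, h (ζ i x) - c)) ∂μ
        - (∫ x, ψ (v * (∑ i ∈ blocks p q k, h (ζ i x) - a)) ∂μ)
        * ∫ x, φ (v * (∑ i ∈ block p q k, h (ζ i x) - c)) ∂μ| ≤ |v| * (p * g q) := by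
    intro φ ψ hψ hψ1 hφ
    have := hd.abs_cov_bounded_le hζ hg hq (B := block p q k) (p := k * (q + p))
      (fun i hi => le_of_mem_block hi) hh (abs_pos.2 hv) hφ (hψ.comp hA') (fun x => hψ1 _)
    rw [card_block] at this
    exact this
  refine norm_integral_cexp_add_sub_le (A := fun x => v * (∑ i ∈ blocks p q k, h (ζ i x) - a))
    (V := fun x => v * (∑ i ∈ block p q k, h (ζ i x) - c))
    (((hm _).sub_const a).const_mul v).aemeasurable
    (((hm _).sub_const c).const_mul v).aemeasurable ?_ ?_ ?_ ?_
  · exact key _ _ Real.measurable_cos Real.abs_cos_le_one hcos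
  · exact key _ _ Real.measurable_sin Real.abs_sin_le_one hsin
  · exact key _ _ Real.measurable_cos Real.abs_cos_le_one hsin
  · exact key _ _ Real.measurable_sin Real.abs_sin_le_one hcos

theorem norm_sub_mul_le_of_norm_le_one {z z₁ z₂ w₁ w₂ : ℂ} {a b c : ℝ} (hz₂ : ‖z₂‖ ≤ 1)
    (hw₁ : ‖w₁‖ ≤ 1) (h : ‖z - z₁ * z₂‖ ≤ a) (h₁ : ‖z₁ - w₁‖ ≤ b) (h₂ : ‖z₂ - w₂‖ ≤ c) :
    ‖z - w₁ * w₂‖ ≤ a + b + c := by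
  have e : z - w₁ * w₂ = (z - z₁ * z₂) + (z₁ - w₁) * z₂ + w₁ * (z₂ - w₂) := by ring
  rw [e]
  refine norm_add₃_le.trans ?_
  rw [norm_mul, norm_mul]
  have h4 := mul_le_of_le_one_right (norm_nonneg (z₁ - w₁)) hz₂
  have h5 := mul_le_of_le_one_left (norm_nonneg (z₂ - w₂)) hw₁
  linarith

/-- Induction on the number of blocks: all factors have modulus at most 1, so errors add. A new
block costs one decoupling error and one Gaussian error, with `M = 2 * p * T` since a centred sum of
`p` terms bounded by `T` is at most that. -/
theorem CovDecay.norm_integral_cexp_blocks_sub_le (hd : CovDecay μ ζ g)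
    (hζ : ∀ i, Measurable (ζ i)) (hζ2 : ∀ i, MemLp (ζ i) 2 μ) (hg : ∀ k, 0 ≤ g k)
    {h : ℝ → ℝ} (hh : LipschitzWith 1 h) {T : ℝ} (hT : ∀ x, |h x| ≤ T) {p q : ℕ} (hq : 1 ≤ q)
    {v : ℝ} (hv : v ≠ 0) (hvM : |v| * (2 * p * T) ≤ 1) (k : ℕ) :
    ‖∫ x, Complex.exp ((v * (∑ i ∈ blocks p q k, h (ζ i x)
        - ∫ y, ∑ i ∈ blocks p q k, h (ζ i y) ∂μ) : ℝ) * Complex.I) ∂μ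
      - (Real.exp (-(v ^ 2 * (∑ b ∈ Finset.range k,
          variance (fun x => ∑ i ∈ block p q b, h (ζ i x)) μ) / 2)) : ℝ)‖
      ≤ k * (4 * (|v| * (p * g q))) + 2 * |v| ^ 3 * (2 * p * T) * ∑ b ∈ Finset.range k,
          variance (fun x => ∑ i ∈ block p q b, h (ζ i x)) μ := by
  induction k with
  | zero => simp [blocks]
  | succ k ih =>
    have hi : ∀ B : Finset ℕ, Integrable (fun x => ∑ i ∈ B, h (ζ i x)) μ := fun B =>
      (memLp_sum_lipschitz hh hζ2 B).integrable (by norm_num)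
    set c := ∫ y, ∑ i ∈ block p q k, h (ζ i y) ∂μ with hc
    set a := ∫ y, ∑ i ∈ blocks p q k, h (ζ i y) ∂μ with ha
    set s := ∑ b ∈ Finset.range k, variance (fun x => ∑ i ∈ block p q b, h (ζ i x)) μ with hs
    set w := variance (fun x => ∑ i ∈ block p q k, h (ζ i x)) μ with hw
    have h1 := hd.norm_integral_cexp_blocks_succ_le hζ hg hh hq hv (p := p) k a c
    have hbV : ∀ x, |∑ i ∈ block p q k, h (ζ i x)| ≤ p * T := by
      intro x
      refine (Finset.abs_sum_le_sum_abs _ _).trans ?_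
      refine (Finset.sum_le_card_nsmul _ _ T fun i _ => hT _).trans ?_
      rw [card_block, nsmul_eq_mul]
    have hbc : |c| ≤ p * T := by
      have := norm_integral_le_of_norm_le_const (μ := μ)
        (f := fun x => ∑ i ∈ block p q k, h (ζ i x)) (ae_of_all _ hbV)
      simpa using this
    have h2 := norm_integral_cexp_sub_gaussian_le (μ := μ) (M := 2 * p * T) (v := v)
      (D := fun x => ∑ i ∈ block p q k, h (ζ i x) - c) ((hi _).aemeasurable.sub_const c)
      (fun x => (abs_sub _ _).trans (by linarith [hbV x])) hvM
      (by rw [integral_sub (hi _) (integrable_const c)]; simp [hc])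
    rw [variance_sub_const (hi _).aestronglyMeasurable c, ← hw] at h2
    have e1 : ∀ x, v * (∑ i ∈ blocks p q (k + 1), h (ζ i x)
        - ∫ y, ∑ i ∈ blocks p q (k + 1), h (ζ i y) ∂μ)
        = v * (∑ i ∈ blocks p q k, h (ζ i x) - a) + v * (∑ i ∈ block p q k, h (ζ i x) - c) := by
      intro x
      have : ∫ y, ∑ i ∈ blocks p q (k + 1), h (ζ i y) ∂μ = a + c := by
        simp only [sum_blocks_succ]
        exact integral_add (hi _) (hi _)
      rw [this, sum_blocks_succ]; ring
    simp only [e1]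
    rw [Finset.sum_range_succ, ← hs, ← hw]
    have hs0 : 0 ≤ s := Finset.sum_nonneg fun b _ => variance_nonneg _ _
    clear_value s w
    have e2 : Real.exp (-(v ^ 2 * (s + w) / 2))
        = Real.exp (-(v ^ 2 * s / 2)) * Real.exp (-(v ^ 2 * w / 2)) := by
      rw [← Real.exp_add]; congr 1; ring
    rw [e2, Complex.ofReal_mul]
    have hG1 : ‖((Real.exp (-(v ^ 2 * s / 2)) : ℝ) : ℂ)‖ ≤ 1 := by
      rw [Complex.norm_real, Real.norm_eq_abs, Real.abs_exp, Real.exp_le_one_iff]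
      exact neg_nonpos.2 (div_nonneg (mul_nonneg (sq_nonneg v) hs0) zero_le_two)
    refine (norm_sub_mul_le_of_norm_le_one
      (norm_integral_cexp_le (μ := μ) fun x => v * (∑ i ∈ block p q k, h (ζ i x) - c)) hG1
      h1 ih h2).trans (le_of_eq ?_)
    push_cast
    ring

/-- The variance is almost additive: adding a block contributes a cross term twice the covariance
with the earlier blocks, which are at distance at least `q`. -/
theorem CovDecay.abs_variance_blocks_sub_le (hd : CovDecay μ ζ g)
    (hζ2 : ∀ i, MemLp (ζ i) 2 μ) (hg : ∀ k, 0 ≤ g k)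
    {h : ℝ → ℝ} (hh : LipschitzWith 1 h) {p q : ℕ} (hq : 1 ≤ q) (k : ℕ) {V : ℝ}
    (hV : ∀ j ≤ k, variance (fun x => ∑ i ∈ blocks p q j, h (ζ i x)) μ ≤ V) :
    |variance (fun x => ∑ i ∈ blocks p q k, h (ζ i x)) μ
      - ∑ b ∈ Finset.range k, variance (fun x => ∑ i ∈ block p q b, h (ζ i x)) μ|
      ≤ k * (2 * (√V * (p * g q))) := by
  induction k with
  | zero =>
    have : variance (fun _ : E => (0 : ℝ)) μ = 0 := variance_zero μ
    simp [blocks, this]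
  | succ k ih =>
    have ih' := ih fun j hj => hV j (by omega)
    have hm : ∀ B : Finset ℕ, MemLp (fun x => ∑ i ∈ B, h (ζ i x)) 2 μ := fun B =>
      memLp_sum_lipschitz hh hζ2 B
    have h1 := hd.abs_cov_past_le hζ2 hq (B := block p q k) (p := k * (q + p))
      (fun i hi => le_of_mem_block hi) hh (measurable_past_blocks hh p q k) (hm _)
    rw [card_block] at h1
    simp only [sum_blocks_succ]
    rw [variance_fun_add (hm _) (hm _), Finset.sum_range_succ]
    have h2 : √(variance (fun x => ∑ i ∈ blocks p q k, h (ζ i x)) μ) * (p * g q)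
        ≤ √V * (p * g q) :=
      mul_le_mul_of_nonneg_right (Real.sqrt_le_sqrt (hV k (by omega)))
        (mul_nonneg (Nat.cast_nonneg _) (hg q))
    have h3 := h1.trans h2
    rw [abs_le] at *
    push_cast
    constructor <;> linarith [ih'.1, ih'.2, h3.1, h3.2]

end Blocks

/-! ### Quantitative Gaussian comparison for the whole sum -/

section CLT

variable {E : Type*} {mE : MeasurableSpace E} {μ : Measure E} [IsProbabilityMeasure μ]
  {ζ : ℕ → E → ℝ} {g : ℕ → ℝ}

theorem abs_exp_neg_sub_exp_neg_le {a b : ℝ} (ha : 0 ≤ a) (hb : 0 ≤ b) :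
    |Real.exp (-a) - Real.exp (-b)| ≤ |a - b| := by
  wlog h : a ≤ b generalizing a b
  · rw [abs_sub_comm, abs_sub_comm a b]
    exact this hb ha (le_of_not_ge h)
  have h1 : Real.exp (-b) ≤ Real.exp (-a) := Real.exp_le_exp.2 (by linarith)
  rw [abs_of_nonneg (by linarith), abs_of_nonpos (by linarith)]
  have h2 : Real.exp (-b) = Real.exp (-a) * Real.exp (-(b - a)) := by
    rw [← Real.exp_add]; congr 1; ring
  have h3 := Real.add_one_le_exp (-(b - a))
  have h4 : Real.exp (-a) ≤ 1 := Real.exp_le_one_iff.2 (by linarith)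
  have h5 := Real.exp_pos (-a)
  rw [h2]
  nlinarith

/-- Three replacements: the full sum by the truncated sum over the blocks, its characteristic
function by a Gaussian with the summed block variances, and these by the variance of the full sum.
`D` bounds the standard deviation of what the first one discards. -/
theorem CovDecay.norm_integral_cexp_sum_sub_le (hd : CovDecay μ ζ g)
    (hζ : ∀ i, Measurable (ζ i)) (hζ2 : ∀ i, MemLp (ζ i) 2 μ) (hg : ∀ k, 0 ≤ g k)
    (hs : Summable g) {K κ T : ℝ} (hK : ∀ i, √(∫ x, ζ i x ^ 2 ∂μ) ≤ K) (hT : 0 ≤ T)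
    (hκ : ∀ i, √(∫ x, (ζ i x - clamp T (ζ i x)) ^ 2 ∂μ) ≤ κ) {n p q k : ℕ} (hq : 1 ≤ q)
    (hk : k * (q + p) ≤ n) {v : ℝ} (hv : v ≠ 0) (hvM : |v| * (2 * p * T) ≤ 1) {C D : ℝ}
    (hC : C = K ^ 2 + 2 * K * ∑' k, g k)
    (hD : D = √((n - k * p : ℝ) * C) + √(n * (κ ^ 2 + 2 * κ * ∑' k, g k))) :
    ‖∫ x, Complex.exp ((v * (∑ i ∈ Finset.range n, ζ i x
        - ∫ y, ∑ i ∈ Finset.range n, ζ i y ∂μ) : ℝ) * Complex.I) ∂μ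
      - (Real.exp (-(v ^ 2 * variance (fun x => ∑ i ∈ Finset.range n, ζ i x) μ / 2)) : ℝ)‖
      ≤ |v| * D + 4 * (|v| * (n * g q)) + 4 * |v| ^ 3 * p * T * (n * C)
        + v ^ 2 / 2 * (2 * (√(n * C) * (n * g q)) + D * (2 * √(n * C) + D)) := by
  have hh := lipschitz_clamp T
  have hψ := lipschitz_sub_clamp hT
  have hgq := hg q
  have hK0 : 0 ≤ K := (Real.sqrt_nonneg _).trans (hK 0)
  have hΘ : 0 ≤ ∑' k, g k := tsum_nonneg hg
  have hC0 : 0 ≤ C := by rw [hC]; positivity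
  have hKc : ∀ i, √(∫ x, clamp T (ζ i x) ^ 2 ∂μ) ≤ K := fun i =>
    (Real.sqrt_le_sqrt (integral_mono (memLp_comp_lipschitz hh (hζ2 i)).integrable_sq
      (hζ2 i).integrable_sq fun x => sq_le_sq.2 (abs_clamp_le_abs hT _))).trans (hK i)
  have hvar : ∀ I : Finset ℕ, variance (fun x => ∑ i ∈ I, clamp T (ζ i x)) μ ≤ I.card * C := by
    intro I; rw [hC]; exact hd.variance_sum_le hζ2 hg hs hh hKc I
  have hvarψ := hd.variance_sum_le hζ2 hg hs hψ hκ (Finset.range n)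
  rw [Finset.card_range] at hvarψ
  have hm : ∀ I : Finset ℕ, MemLp (fun x => ∑ i ∈ I, clamp T (ζ i x)) 2 μ := fun I =>
    memLp_sum_lipschitz hh hζ2 I
  have hmψ : MemLp (fun x => ∑ i ∈ Finset.range n, (ζ i x - clamp T (ζ i x))) 2 μ :=
    memLp_sum_lipschitz hψ hζ2 _
  have hkp : k * p ≤ n := (Nat.mul_le_mul_left k (by omega)).trans hk
  have hkpR : (k : ℝ) * p ≤ n := by exact_mod_cast hkp
  have hsub : blocks p q k ⊆ Finset.range n := fun i hi =>
    Finset.mem_range.2 ((lt_of_mem_blocks hi).trans_le hk)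
  set R := Finset.range n \ blocks p q k with hR
  have hRc : (R.card : ℝ) = n - k * p := by
    rw [hR, Finset.card_sdiff_of_subset hsub, Finset.card_range, card_blocks, Nat.cast_sub hkp]
    push_cast; ring
  set A : E → ℝ := fun x => ∑ i ∈ blocks p q k, clamp T (ζ i x) with hA
  -- All that is discarded: the truncated terms in the gaps and the final incomplete stretch, and
  -- the truncation remainders of all `n` terms.
  set Y : E → ℝ := fun x => ∑ i ∈ R, clamp T (ζ i x)
    + ∑ i ∈ Finset.range n, (ζ i x - clamp T (ζ i x)) with hY
  have hYm : MemLp Y 2 μ := (hm R).add hmψ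
  have hZ : ∀ x, ∑ i ∈ Finset.range n, ζ i x = A x + Y x := by
    intro x
    have h1 := Finset.sum_sdiff (f := fun i => clamp T (ζ i x)) hsub
    have h2 : ∑ i ∈ Finset.range n, (ζ i x - clamp T (ζ i x))
      = ∑ i ∈ Finset.range n, ζ i x - ∑ i ∈ Finset.range n, clamp T (ζ i x) :=
      Finset.sum_sub_distrib _ _
    simp only [hA, hY]
    rw [h2, ← h1]
    ring
  have hYv : √(variance Y μ) ≤ D := by
    refine (sqrt_variance_add_le (hm R) hmψ).trans ?_
    rw [hD]
    refine add_le_add (Real.sqrt_le_sqrt ?_) (Real.sqrt_le_sqrt hvarψ)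
    rw [← hRc]; exact hvar R
  have hD0 : 0 ≤ D := (Real.sqrt_nonneg _).trans hYv
  have hvarA : ∀ j ≤ k, variance (fun x => ∑ i ∈ blocks p q j, clamp T (ζ i x)) μ ≤ n * C := by
    intro j hj
    refine (hvar _).trans (mul_le_mul_of_nonneg_right ?_ hC0)
    rw [card_blocks]
    exact_mod_cast (Nat.mul_le_mul_right p hj).trans hkp
  have hAs : √(variance A μ) ≤ √(n * C) := Real.sqrt_le_sqrt (hvarA k le_rfl)
  simp only [hZ]
  have hAi := (hm (blocks p q k)).integrable (by norm_num)
  have hYi := hYm.integrable (by norm_num)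
  have hmean : ∫ y, (A y + Y y) ∂μ = ∫ y, A y ∂μ + ∫ y, Y y ∂μ := integral_add hAi hYi
  set σ₂ := ∑ b ∈ Finset.range k, variance (fun x => ∑ i ∈ block p q b, clamp T (ζ i x)) μ with hσ₂
  have hσ₂0 : 0 ≤ σ₂ := Finset.sum_nonneg fun b _ => variance_nonneg _ _
  have hσ₂n : σ₂ ≤ n * C := by
    refine (Finset.sum_le_card_nsmul _ _ (p * C) fun b _ => ?_).trans ?_
    · have := hvar (block p q b); rwa [card_block] at this
    · rw [Finset.card_range, nsmul_eq_mul, ← mul_assoc]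
      exact mul_le_mul_of_nonneg_right hkpR hC0
  have b1 : ‖∫ x, Complex.exp ((v * (A x + Y x - ∫ y, (A y + Y y) ∂μ) : ℝ) * Complex.I) ∂μ
      - ∫ x, Complex.exp ((v * (A x - ∫ y, A y ∂μ) : ℝ) * Complex.I) ∂μ‖ ≤ |v| * D := by
    have h1 := norm_integral_cexp_sub_le (μ := μ) (X := fun x => v * (A x - ∫ y, A y ∂μ))
      (Y := fun x => v * (Y x - ∫ y, Y y ∂μ))
      (((hm (blocks p q k)).sub (memLp_const (∫ y, A y ∂μ))).const_mul v)
      ((hYm.sub (memLp_const (∫ y, Y y ∂μ))).const_mul v)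
    have e1 : ∀ x, v * (A x + Y x - ∫ y, (A y + Y y) ∂μ)
        = v * (A x - ∫ y, A y ∂μ) + v * (Y x - ∫ y, Y y ∂μ) := by
      intro x; rw [hmean]; ring
    simp only [e1]
    refine h1.trans ?_
    simp only [mul_pow]
    rw [integral_const_mul, Real.sqrt_mul (sq_nonneg v), Real.sqrt_sq_eq_abs,
      ← variance_eq_integral hYm.aemeasurable]
    exact mul_le_mul_of_nonneg_left hYv (abs_nonneg v)
  have b2 := hd.norm_integral_cexp_blocks_sub_le hζ hζ2 hg hh (abs_clamp_le hT) hq hv hvM k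
  have b3 := hd.abs_variance_blocks_sub_le hζ2 hg hh hq k hvarA
  have b4 := abs_variance_add_sub_le (hm (blocks p q k)) hYm
  rw [← hσ₂] at b2 b3
  have hkg : (k : ℝ) * (p * g q) ≤ n * g q := by
    rw [← mul_assoc]; exact mul_le_mul_of_nonneg_right hkpR hgq
  have b5 : |σ₂ - variance (fun x => A x + Y x) μ|
      ≤ 2 * (√(n * C) * (n * g q)) + D * (2 * √(n * C) + D) := by
    have c1 : |σ₂ - variance A μ| ≤ 2 * (√(n * C) * (n * g q)) := by
      rw [abs_sub_comm]
      refine b3.trans ?_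
      have := mul_le_mul_of_nonneg_left hkg (Real.sqrt_nonneg (n * C))
      linarith
    have c2 : |variance A μ - variance (fun x => A x + Y x) μ| ≤ D * (2 * √(n * C) + D) := by
      rw [abs_sub_comm]
      refine b4.trans (mul_le_mul hYv (by linarith) (by positivity) hD0)
    exact (abs_sub_le _ _ _).trans (add_le_add c1 c2)
  have b6 : ‖((Real.exp (-(v ^ 2 * σ₂ / 2)) : ℝ) : ℂ)
      - (Real.exp (-(v ^ 2 * variance (fun x => A x + Y x) μ / 2)) : ℝ)‖
      ≤ v ^ 2 / 2 * (2 * (√(n * C) * (n * g q)) + D * (2 * √(n * C) + D)) := by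
    rw [← Complex.ofReal_sub, Complex.norm_real]
    have hV0 := variance_nonneg (fun x => A x + Y x) μ
    refine (abs_exp_neg_sub_exp_neg_le (div_nonneg (mul_nonneg (sq_nonneg v) hσ₂0) zero_le_two)
      (div_nonneg (mul_nonneg (sq_nonneg v) hV0) zero_le_two)).trans ?_
    have e : v ^ 2 * σ₂ / 2 - v ^ 2 * variance (fun x => A x + Y x) μ / 2
      = v ^ 2 / 2 * (σ₂ - variance (fun x => A x + Y x) μ) := by ring
    rw [e, abs_mul, abs_of_nonneg (by positivity : 0 ≤ v ^ 2 / 2)]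
    exact mul_le_mul_of_nonneg_left b5 (by positivity)
  have b7 : k * (4 * (|v| * (p * g q))) + 2 * |v| ^ 3 * (2 * p * T) * σ₂
      ≤ 4 * (|v| * (n * g q)) + 4 * |v| ^ 3 * p * T * (n * C) := by
    have c1 := mul_le_mul_of_nonneg_left hkg (abs_nonneg v)
    have c2 := mul_le_mul_of_nonneg_left hσ₂n (by positivity : 0 ≤ 4 * |v| ^ 3 * p * T)
    linarith
  have t1 := norm_sub_le_norm_sub_add_norm_sub
    (∫ x, Complex.exp ((v * (A x + Y x - ∫ y, (A y + Y y) ∂μ) : ℝ) * Complex.I) ∂μ)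
    (∫ x, Complex.exp ((v * (A x - ∫ y, A y ∂μ) : ℝ) * Complex.I) ∂μ)
    ((Real.exp (-(v ^ 2 * variance (fun x => A x + Y x) μ / 2)) : ℝ) : ℂ)
  have t2 := norm_sub_le_norm_sub_add_norm_sub
    (∫ x, Complex.exp ((v * (A x - ∫ y, A y ∂μ) : ℝ) * Complex.I) ∂μ)
    ((Real.exp (-(v ^ 2 * σ₂ / 2)) : ℝ) : ℂ)
    ((Real.exp (-(v ^ 2 * variance (fun x => A x + Y x) μ / 2)) : ℝ) : ℂ)
  have b2' := b2.trans b7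
  linarith

end CLT

/-! ### Choice of block sizes and the central limit theorem -/

section CLT

theorem tendsto_const_mul_rpow_neg (c : ℝ) {r : ℝ} (hr : 0 < r) :
    Tendsto (fun n : ℕ => c * (n : ℝ) ^ (-r)) atTop (𝓝 0) := by
  simpa using ((tendsto_rpow_neg_atTop hr).comp tendsto_natCast_atTop_atTop).const_mul c

/-- Sizes of the gaps and of the big blocks for the blocking argument. -/
theorem exists_block_sizes {g : ℕ → ℝ} (hg : ∀ k, 0 ≤ g k)
    (hlim : Tendsto (fun k : ℕ => (k : ℝ) ^ (3 / 2 : ℝ) * g k) atTop (𝓝 0)) :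
    ∃ p q k : ℕ → ℕ, (∀ n, 1 ≤ n → 1 ≤ q n) ∧ (∀ n, k n * (q n + p n) ≤ n) ∧
      Tendsto (fun n : ℕ => √n * g (q n)) atTop (𝓝 0) ∧
      Tendsto (fun n : ℕ => p n / √n) atTop (𝓝 0) ∧
      Tendsto (fun n : ℕ => ((n : ℝ) - k n * p n) / n) atTop (𝓝 0) := by
  -- The exponent 1/3 makes `√n ≤ q ^ (3/2)`, matching the decay of `g`. The exponent 5/12 lies
  -- strictly between 1/3 and 1/2: gaps are negligible against blocks, and blocks against `√n`.
  set q : ℕ → ℕ := fun n => ⌈(n : ℝ) ^ (1 / 3 : ℝ)⌉₊ with hq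
  set p : ℕ → ℕ := fun n => ⌈(n : ℝ) ^ (5 / 12 : ℝ)⌉₊ with hp
  have hceil : ∀ n : ℕ, 1 ≤ n → ∀ r : ℝ, 0 ≤ r →
      (n : ℝ) ^ r ≤ ⌈(n : ℝ) ^ r⌉₊ ∧ (⌈(n : ℝ) ^ r⌉₊ : ℝ) ≤ 2 * (n : ℝ) ^ r := by
    intro n hn r hr
    have hn' : (1 : ℝ) ≤ n := by exact_mod_cast hn
    have h1 := Real.one_le_rpow hn' hr
    have h2 := Nat.ceil_lt_add_one (zero_le_one.trans h1)
    exact ⟨Nat.le_ceil _, by linarith⟩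
  have hqtop : Tendsto q atTop atTop :=
    tendsto_nat_ceil_atTop.comp
      ((tendsto_rpow_atTop (by norm_num)).comp tendsto_natCast_atTop_atTop)
  refine ⟨p, q, fun n => n / (q n + p n), ?_, fun n => Nat.div_mul_le_self _ _, ?_, ?_, ?_⟩
  · intro n hn
    have : (1 : ℝ) ≤ (n : ℝ) ^ (1 / 3 : ℝ) :=
      Real.one_le_rpow (by exact_mod_cast hn) (by norm_num)
    exact Nat.one_le_ceil_iff.2 (by linarith)
  · refine squeeze_zero' (Eventually.of_forall fun n => mul_nonneg (Real.sqrt_nonneg _) (hg _)) ?_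
      (hlim.comp hqtop)
    filter_upwards [eventually_ge_atTop 1] with n hn
    refine mul_le_mul_of_nonneg_right ?_ (hg _)
    have h1 := (hceil n hn (1 / 3) (by norm_num)).1
    have h2 : √(n : ℝ) = ((n : ℝ) ^ (1 / 3 : ℝ)) ^ (3 / 2 : ℝ) := by
      rw [← Real.rpow_mul (Nat.cast_nonneg n), Real.sqrt_eq_rpow]; norm_num
    rw [h2]
    exact Real.rpow_le_rpow (by positivity) h1 (by norm_num)
  · refine squeeze_zero' (Eventually.of_forall fun n => by positivity) ?_
      (tendsto_const_mul_rpow_neg 2 (r := 1 / 12) (by norm_num))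
    filter_upwards [eventually_ge_atTop 1] with n hn
    have hn' : (0 : ℝ) < n := by exact_mod_cast hn
    rw [div_le_iff₀ (Real.sqrt_pos.2 hn'), Real.sqrt_eq_rpow, mul_assoc, ← Real.rpow_add hn']
    refine (hceil n hn (5 / 12) (by norm_num)).2.trans (le_of_eq ?_)
    norm_num
  -- The indices left out are the gaps, in proportion at most of order `q / p`, and an incomplete
  -- period of length at most `q + p`; this gives the three powers of `n`.
  · have hlim2 := (tendsto_const_mul_rpow_neg 2 (r := 1 / 12) (by norm_num)).add
      ((tendsto_const_mul_rpow_neg 2 (r := 2 / 3) (by norm_num)).add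
      (tendsto_const_mul_rpow_neg 2 (r := 7 / 12) (by norm_num)))
    simp only [add_zero] at hlim2
    have hkey : ∀ n : ℕ, 1 ≤ n → (n : ℝ) ≤ (n / (q n + p n) : ℕ) * p n
        + (n / (q n + p n) : ℕ) * q n + (q n + p n) := by
      intro n hn
      have h1 := Nat.div_add_mod n (q n + p n)
      have hpos : 0 < q n + p n := by
        have : 0 < p n := Nat.ceil_pos.2 (Real.rpow_pos_of_pos (by exact_mod_cast hn) _)
        omega
      have h2 := Nat.mod_lt n hpos
      have h3 : n ≤ (n / (q n + p n)) * p n + (n / (q n + p n)) * q n + (q n + p n) := by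
        nlinarith
      exact_mod_cast h3
    refine squeeze_zero' ?_ ?_ hlim2
    · filter_upwards [eventually_ge_atTop 1] with n hn
      refine div_nonneg (sub_nonneg.2 ?_) (Nat.cast_nonneg n)
      have : n / (q n + p n) * p n ≤ n :=
        (Nat.mul_le_mul_left _ (Nat.le_add_left _ _)).trans (Nat.div_mul_le_self n _)
      exact_mod_cast this
    · filter_upwards [eventually_ge_atTop 1] with n hn
      have hn' : (0 : ℝ) < n := by exact_mod_cast hn
      obtain ⟨hp1, hp2⟩ := hceil n hn (5 / 12) (by norm_num)
      obtain ⟨-, hq2⟩ := hceil n hn (1 / 3) (by norm_num)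
      have hk : ((n / (q n + p n) : ℕ) : ℝ) * p n ≤ n := by
        have : n / (q n + p n) * p n ≤ n :=
          (Nat.mul_le_mul_left _ (Nat.le_add_left _ _)).trans (Nat.div_mul_le_self n _)
        exact_mod_cast this
      have e1 : (n : ℝ) ^ (1 / 3 : ℝ) = (n : ℝ) ^ (-(1 / 12) : ℝ) * (n : ℝ) ^ (5 / 12 : ℝ) := by
        rw [← Real.rpow_add hn']; norm_num
      have e2 : (n : ℝ) ^ (1 / 3 : ℝ) = (n : ℝ) ^ (-(2 / 3) : ℝ) * n := by
        conv_rhs => rw [← Real.rpow_add_one hn'.ne']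
        norm_num
      have e3 : (n : ℝ) ^ (5 / 12 : ℝ) = (n : ℝ) ^ (-(7 / 12) : ℝ) * n := by
        conv_rhs => rw [← Real.rpow_add_one hn'.ne']
        norm_num
      have hkq : ((n / (q n + p n) : ℕ) : ℝ) * q n ≤ 2 * (n : ℝ) ^ (-(1 / 12) : ℝ) * n := by
        have h1 : (q n : ℝ) ≤ 2 * (n : ℝ) ^ (-(1 / 12) : ℝ) * p n := by
          refine hq2.trans ?_
          rw [e1, mul_assoc]
          gcongr
        calc ((n / (q n + p n) : ℕ) : ℝ) * q n
            ≤ ((n / (q n + p n) : ℕ) : ℝ) * (2 * (n : ℝ) ^ (-(1 / 12) : ℝ) * p n) := by gcongr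
          _ = 2 * (n : ℝ) ^ (-(1 / 12) : ℝ) * (((n / (q n + p n) : ℕ) : ℝ) * p n) := by ring
          _ ≤ _ := by gcongr
      rw [div_le_iff₀ hn']
      have := hkey n hn
      have hq3 : (q n : ℝ) ≤ 2 * ((n : ℝ) ^ (-(2 / 3) : ℝ) * n) := by rw [← e2]; exact hq2
      have hp3 : (p n : ℝ) ≤ 2 * ((n : ℝ) ^ (-(7 / 12) : ℝ) * n) := by rw [← e3]; exact hp2
      linarith

variable {E : Type*} {mE : MeasurableSpace E} {μ : Measure E} [IsProbabilityMeasure μ]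
  {ζ : ℕ → E → ℝ} {g : ℕ → ℝ}

/-- The preceding estimate at `v = u / √n` and `D = √n * d`, written in the quantities `√n * g q`
and `p / √n` that tend to 0. -/
theorem CovDecay.norm_charFun_normalized_sub_le (hd : CovDecay μ ζ g)
    (hζ : ∀ i, Measurable (ζ i)) (hζ2 : ∀ i, MemLp (ζ i) 2 μ) (hg : ∀ k, 0 ≤ g k)
    (hs : Summable g) {K κ T : ℝ} (hK : ∀ i, √(∫ x, ζ i x ^ 2 ∂μ) ≤ K) (hT : 0 ≤ T)
    (hκ : ∀ i, √(∫ x, (ζ i x - clamp T (ζ i x)) ^ 2 ∂μ) ≤ κ) {n p q k : ℕ} (hn : 1 ≤ n)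
    (hq : 1 ≤ q) (hk : k * (q + p) ≤ n) {u : ℝ} (hu : u ≠ 0) (huM : |u| * (2 * T * (p / √n)) ≤ 1)
    {C d : ℝ} (hC : C = K ^ 2 + 2 * K * ∑' k, g k)
    (hd' : d = √((n - k * p : ℝ) / n * C) + √(κ ^ 2 + 2 * κ * ∑' k, g k)) :
    ‖∫ x, Complex.exp ((u * ((√n)⁻¹ * (∑ i ∈ Finset.range n, ζ i x
        - ∫ y, ∑ i ∈ Finset.range n, ζ i y ∂μ)) : ℝ) * Complex.I) ∂μ
      - (Real.exp (-(u ^ 2 * (variance (fun x => ∑ i ∈ Finset.range n, ζ i x) μ / n) / 2)) : ℝ)‖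
      ≤ |u| * d + 4 * (|u| * (√n * g q)) + 4 * |u| ^ 3 * T * C * (p / √n)
        + u ^ 2 / 2 * (2 * (√C * (√n * g q)) + d * (2 * √C + d)) := by
  have hn' : (0 : ℝ) < n := by exact_mod_cast hn
  obtain ⟨r, hr⟩ : ∃ r, r = √(n : ℝ) := ⟨_, rfl⟩
  have hr0 : 0 < r := by rw [hr]; exact Real.sqrt_pos.2 hn'
  have hrn : (n : ℝ) = r ^ 2 := by rw [hr, Real.sq_sqrt hn'.le]
  have hD : r * d = √((n - k * p : ℝ) * C) + √(n * (κ ^ 2 + 2 * κ * ∑' k, g k)) := by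
    rw [hd', mul_add, hr, ← Real.sqrt_mul hn'.le, ← Real.sqrt_mul hn'.le, ← mul_assoc,
      mul_div_cancel₀ _ hn'.ne']
  have key := hd.norm_integral_cexp_sum_sub_le hζ hζ2 hg hs hK hT hκ hq hk
    (v := u * r⁻¹) (mul_ne_zero hu (inv_ne_zero hr0.ne')) (by
      rw [abs_mul, abs_of_pos (inv_pos.2 hr0)]
      rw [← hr] at huM
      refine le_trans (le_of_eq ?_) huM
      field_simp) hC hD
  rw [← hr]
  have e1 : ∀ x, u * (r⁻¹ * (∑ i ∈ Finset.range n, ζ i x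
        - ∫ y, ∑ i ∈ Finset.range n, ζ i y ∂μ)) = u * r⁻¹ * (∑ i ∈ Finset.range n, ζ i x
        - ∫ y, ∑ i ∈ Finset.range n, ζ i y ∂μ) := fun x => by ring
  have e2 : u ^ 2 * (variance (fun x => ∑ i ∈ Finset.range n, ζ i x) μ / n) / 2
      = (u * r⁻¹) ^ 2 * variance (fun x => ∑ i ∈ Finset.range n, ζ i x) μ / 2 := by
    rw [hrn]; field_simp
  simp only [e1]
  rw [e2]
  refine key.trans (le_of_eq ?_)
  rw [Real.sqrt_mul hn'.le, ← hr, hrn, abs_mul, abs_of_pos (inv_pos.2 hr0)]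
  field_simp

/-- Central limit theorem for weakly dependent sequences whose normalized variance converges. -/
theorem CovDecay.tendsto_charFun (hd : CovDecay μ ζ g)
    (hζ : ∀ i, Measurable (ζ i)) (hζ2 : ∀ i, MemLp (ζ i) 2 μ)
    (hui : UniformIntegrable (fun i x => (ζ i x) ^ 2) 1 μ) (hg : ∀ k, 0 ≤ g k)
    (hs : Summable g) (hlim : Tendsto (fun k : ℕ => (k : ℝ) ^ (3 / 2 : ℝ) * g k) atTop (𝓝 0))
    {K : ℝ} (hK : ∀ i, √(∫ x, ζ i x ^ 2 ∂μ) ≤ K) {a : ℝ}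
    (ha : Tendsto (fun n : ℕ => variance (fun x => ∑ i ∈ Finset.range n, ζ i x) μ / n)
      atTop (𝓝 a)) (u : ℝ) :
    Tendsto (fun n : ℕ => ∫ x, Complex.exp ((u * ((√n)⁻¹ * (∑ i ∈ Finset.range n, ζ i x
        - ∫ y, ∑ i ∈ Finset.range n, ζ i y ∂μ)) : ℝ) * Complex.I) ∂μ) atTop
      (𝓝 ((Real.exp (-(u ^ 2 * a / 2)) : ℝ) : ℂ)) := by
  rcases eq_or_ne u 0 with rfl | hu
  · simp
  obtain ⟨p, q, k, hq, hk, l1, l2, l3⟩ := exists_block_sizes hg hlim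
  obtain ⟨C, hC⟩ : ∃ C, C = K ^ 2 + 2 * K * ∑' k, g k := ⟨_, rfl⟩
  have hgauss : Tendsto (fun n : ℕ => ((Real.exp (-(u ^ 2 *
      (variance (fun x => ∑ i ∈ Finset.range n, ζ i x) μ / n) / 2)) : ℝ) : ℂ)) atTop
      (𝓝 ((Real.exp (-(u ^ 2 * a / 2)) : ℝ) : ℂ)) :=
    (Complex.continuous_ofReal.tendsto _).comp
      ((Real.continuous_exp.tendsto _).comp (((ha.const_mul (u ^ 2)).div_const 2).neg))
  rw [Metric.tendsto_nhds]
  intro ε hε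
  -- The part of the error due to truncation; it does not decrease with `n`.
  set s : ℝ → ℝ := fun κ => √(κ ^ 2 + 2 * κ * ∑' k, g k) with hsdef
  have hF : Tendsto (fun κ : ℝ => |u| * s κ + u ^ 2 / 2 * (s κ * (2 * √C + s κ))) (𝓝[>] 0)
      (𝓝 0) := by
    have hc : Continuous (fun κ : ℝ => |u| * s κ + u ^ 2 / 2 * (s κ * (2 * √C + s κ))) := by
      fun_prop
    have := hc.tendsto 0
    simp only [hsdef] at this
    norm_num at this
    exact this.mono_left nhdsWithin_le_nhds
  -- The order of choices matters: first `κ`, then the level `T`, and only then `n → ∞` with `T`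
  -- fixed, since `T` multiplies `p / √n`.
  obtain ⟨κ, hκ0, hκε⟩ : ∃ κ : ℝ, 0 < κ ∧
      |u| * s κ + u ^ 2 / 2 * (s κ * (2 * √C + s κ)) < ε / 2 := by
    have := (hF.eventually (gt_mem_nhds (half_pos hε))).and self_mem_nhdsWithin
    obtain ⟨κ, h1, h2⟩ := this.exists
    exact ⟨κ, h2, h1⟩
  obtain ⟨T, hT, hTκ⟩ := exists_sqrt_integral_sub_clamp_le hζ2 hui hκ0
  have hdlim : Tendsto (fun n : ℕ => √(((n : ℝ) - k n * p n) / n * C) + s κ) atTop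
      (𝓝 (s κ)) := by
    have := ((Real.continuous_sqrt.tendsto _).comp (l3.mul_const C)).add_const (s κ)
    simpa using this
  have hR : Tendsto (fun n : ℕ => |u| * (√(((n : ℝ) - k n * p n) / n * C) + s κ)
      + 4 * (|u| * (√n * g (q n))) + 4 * |u| ^ 3 * T * C * (p n / √n)
        + u ^ 2 / 2 * (2 * (√C * (√n * g (q n))) + (√(((n : ℝ) - k n * p n) / n * C) + s κ)
          * (2 * √C + (√(((n : ℝ) - k n * p n) / n * C) + s κ)))) atTop
      (𝓝 (|u| * s κ + 4 * (|u| * 0) + 4 * |u| ^ 3 * T * C * 0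
        + u ^ 2 / 2 * (2 * (√C * 0) + s κ * (2 * √C + s κ)))) :=
    (((hdlim.const_mul _).add ((l1.const_mul _).const_mul _)).add (l2.const_mul _)).add
      ((((l1.const_mul _).const_mul _).add (hdlim.mul (hdlim.const_add _))).const_mul _)
  have hR' := hR.eventually_lt_const (u := ε / 2) (by simpa using hκε)
  have hsmall : ∀ᶠ n : ℕ in atTop, |u| * (2 * T * (p n / √n)) ≤ 1 := by
    have h0 := (l2.const_mul (2 * T)).const_mul |u|
    simp only [mul_zero] at h0
    exact h0.eventually (ge_mem_nhds zero_lt_one)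
  have hga := (Metric.tendsto_nhds.1 hgauss) (ε / 2) (half_pos hε)
  filter_upwards [hR', hsmall, hga, eventually_ge_atTop 1] with n h1 h2 h3 h4
  have key := hd.norm_charFun_normalized_sub_le hζ hζ2 hg hs hK hT hTκ h4 (hq n h4) (hk n) hu h2
    hC rfl
  rw [dist_eq_norm] at h3 ⊢
  have := norm_sub_le_norm_sub_add_norm_sub
    (∫ x, Complex.exp ((u * ((√n)⁻¹ * (∑ i ∈ Finset.range n, ζ i x
        - ∫ y, ∑ i ∈ Finset.range n, ζ i y ∂μ)) : ℝ) * Complex.I) ∂μ)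
    ((Real.exp (-(u ^ 2 * (variance (fun x => ∑ i ∈ Finset.range n, ζ i x) μ / n) / 2)) : ℝ) : ℂ)
    ((Real.exp (-(u ^ 2 * a / 2)) : ℝ) : ℂ)
  linarith

end CLT

/-! ### Averages through residue classes -/

section Cesaro

theorem sum_range_mul_residues (y : ℕ → ℝ) (m k : ℕ) :
    ∑ i ∈ Finset.range (m * k), y i
      = ∑ r ∈ Finset.range k, ∑ a ∈ Finset.range m, y (a * k + r) := by
  induction m with
  | zero => simp
  | succ m ih =>
    rw [Nat.succ_mul, Finset.sum_range_add, ih, ← Finset.sum_add_distrib]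
    exact Finset.sum_congr rfl fun r _ => (Finset.sum_range_succ _ _).symm

/-- At most `k` terms fall outside the complete periods. For the others, with `m = n / k`, the crude
`1 / n ≤ 1 / m` suffices because the limit is 0. -/
theorem tendsto_average_zero_of_residues {y : ℕ → ℝ} {B : ℝ} (hB : ∀ i, |y i| ≤ B) {k : ℕ}
    (hk : 1 ≤ k) (h : ∀ r, Tendsto
      (fun m : ℕ => (m : ℝ)⁻¹ * ∑ a ∈ Finset.range m, y (a * k + r)) atTop (𝓝 0)) :
    Tendsto (fun n : ℕ => (n : ℝ)⁻¹ * ∑ i ∈ Finset.range n, y i) atTop (𝓝 0) := by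
  have hB0 : 0 ≤ B := (abs_nonneg _).trans (hB 0)
  have h1 : Tendsto (fun m : ℕ => ∑ r ∈ Finset.range k,
      (m : ℝ)⁻¹ * ∑ a ∈ Finset.range m, y (a * k + r)) atTop (𝓝 0) := by
    simpa using tendsto_finsetSum (Finset.range k) fun r _ => h r
  have h2 := (h1.comp (Nat.tendsto_div_const_atTop (n := k) (by omega))).abs
  have h3 : Tendsto (fun n : ℕ => (k * B) * (n : ℝ)⁻¹) atTop (𝓝 0) := by
    simpa using (tendsto_inv_atTop_nhds_zero_nat (𝕜 := ℝ)).const_mul (k * B)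
  have h4 := h2.add h3
  simp only [abs_zero, add_zero] at h4
  refine squeeze_zero_norm (fun n => ?_) h4
  rcases Nat.eq_zero_or_pos n with rfl | hn
  · simp
  have hn' : (0 : ℝ) < n := by exact_mod_cast hn
  simp only [Function.comp_apply, Real.norm_eq_abs]
  set m := n / k with hm
  have hmk : m * k ≤ n := Nat.div_mul_le_self n k
  have e1 : ∑ i ∈ Finset.range n, y i
      = ∑ r ∈ Finset.range k, ∑ a ∈ Finset.range m, y (a * k + r)
        + ∑ i ∈ Finset.Ico (m * k) n, y i := by
    rw [← sum_range_mul_residues, Finset.sum_range_add_sum_Ico _ hmk]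
  have e2 : |∑ i ∈ Finset.Ico (m * k) n, y i| ≤ k * B := by
    refine (Finset.abs_sum_le_sum_abs _ _).trans
      ((Finset.sum_le_card_nsmul _ _ B fun i _ => hB i).trans ?_)
    rw [Nat.card_Ico, nsmul_eq_mul]
    refine mul_le_mul_of_nonneg_right ?_ hB0
    have h5 := Nat.div_add_mod n k
    have h6 := Nat.mod_lt n hk
    have : n - m * k ≤ k := by
      rw [hm, mul_comm]; omega
    exact_mod_cast this
  rw [← Finset.mul_sum]
  set s := ∑ r ∈ Finset.range k, ∑ a ∈ Finset.range m, y (a * k + r)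
  rw [e1, mul_add]
  refine (abs_add_le _ _).trans (add_le_add ?_ ?_)
  · rcases Nat.eq_zero_or_pos m with hm0 | hm0
    · have : s = 0 := by simp [s, hm0]
      simp [this]
    · rw [abs_mul, abs_mul]
      refine mul_le_mul_of_nonneg_right ?_ (abs_nonneg _)
      have hm' : (0 : ℝ) < m := by exact_mod_cast hm0
      rw [abs_of_pos (inv_pos.2 hn'), abs_of_pos (inv_pos.2 hm')]
      refine inv_anti₀ hm' ?_
      exact_mod_cast Nat.div_le_self n k
  · rw [abs_mul, abs_of_pos (inv_pos.2 hn'), mul_comm]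
    exact mul_le_mul_of_nonneg_right e2 (inv_pos.2 hn').le

theorem tendsto_average_of_residues {y : ℕ → ℝ} {B : ℝ} (hB : ∀ i, |y i| ≤ B) {k : ℕ}
    (hk : 1 ≤ k) {e : ℝ} (h : ∀ r, Tendsto
      (fun m : ℕ => (m : ℝ)⁻¹ * ∑ a ∈ Finset.range m, y (a * k + r)) atTop (𝓝 e)) :
    Tendsto (fun n : ℕ => (n : ℝ)⁻¹ * ∑ i ∈ Finset.range n, y i) atTop (𝓝 e) := by
  -- Subtracting `e` from every term reduces to limit 0, where the crude comparison is available.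
  have hsub : ∀ z : ℕ → ℝ, Tendsto (fun n : ℕ => (n : ℝ)⁻¹ * ∑ i ∈ Finset.range n, z i) atTop (𝓝 e)
      ↔ Tendsto (fun n : ℕ => (n : ℝ)⁻¹ * ∑ i ∈ Finset.range n, (z i - e)) atTop (𝓝 0) := by
    intro z
    rw [← tendsto_sub_nhds_zero_iff]
    refine tendsto_congr' ?_
    filter_upwards [eventually_ge_atTop 1] with n hn
    have hn' : (n : ℝ) ≠ 0 := by exact_mod_cast (by omega : n ≠ 0)
    rw [Finset.sum_sub_distrib, Finset.sum_const, Finset.card_range, nsmul_eq_mul]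
    field_simp
  rw [hsub]
  exact tendsto_average_zero_of_residues (B := B + |e|)
    (fun i => (abs_sub _ _).trans (by linarith [hB i])) hk fun r => (hsub _).1 (h r)

end Cesaro

/-! ### Increments of the walk and the Green function -/

section Walk

variable {Ω : Type*} {mΩ : MeasurableSpace Ω} {P : Measure Ω}
  {X : ℕ → Ω → ℕ}

theorem measurable_walk (hX : ∀ i, Measurable (X i)) (n : ℕ) : Measurable (walk X n) :=
  Finset.measurable_fun_sum _ fun i _ => hX i

theorem walk_add_sub (X : ℕ → Ω → ℕ) (i k : ℕ) (ω : Ω) :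
    walk X (i + k) ω - walk X i ω = ∑ j ∈ Finset.Ico i (i + k), X j ω := by
  rw [walk, walk, ← Finset.sum_range_add_sum_Ico _ (Nat.le_add_right i k), Nat.add_sub_cancel_left]

theorem strictMono_walk {ω : Ω} (h : ∀ i, 1 ≤ X i ω) : StrictMono (fun n => walk X n ω) :=
  strictMono_nat_of_lt_succ fun n => by
    have := h n
    simp only [walk, Finset.sum_range_succ]
    omega

/-- The shifted sequence of steps has the same joint law as the original one, and the increment is
the same function of it. -/
theorem identDistrib_walk_increment (hXindep : iIndepFun X P)
    (hXident : ∀ i, IdentDistrib (X i) (X 0) P P) (i k : ℕ) :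
    IdentDistrib (fun ω => walk X (i + k) ω - walk X i ω) (walk X k) P P := by
  have h1 : IdentDistrib (fun ω j => X (i + j) ω) (fun ω j => X j ω) P P :=
    IdentDistrib.pi (fun j => (hXident (i + j)).trans (hXident j).symm)
      (hXindep.precomp (add_right_injective i)) hXindep
  have h2 := h1.comp (u := fun x : ℕ → ℕ => ∑ j ∈ Finset.range k, x j) (by fun_prop)
  have h3 : (fun ω => walk X (i + k) ω - walk X i ω)
      = (fun x : ℕ → ℕ => ∑ j ∈ Finset.range k, x j) ∘ (fun ω j => X (i + j) ω) := by
    ext ω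
    rw [walk_add_sub, Finset.sum_Ico_eq_sum_range, Nat.add_sub_cancel_left]
    rfl
  rw [h3]
  exact h2

theorem indepFun_walk_increment (hX : ∀ i, Measurable (X i)) (hXindep : iIndepFun X P)
    {i j k : ℕ} (hij : i + k ≤ j) :
    IndepFun (fun ω => walk X (i + k) ω - walk X i ω)
      (fun ω => walk X (j + k) ω - walk X j ω) P := by
  have hdisj : Disjoint (Finset.Ico i (i + k)) (Finset.Ico j (j + k)) := by
    rw [Finset.disjoint_left]
    intro a ha hb
    rw [Finset.mem_Ico] at ha hb
    omega
  have h1 := hXindep.indepFun_finset _ _ hdisj hX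
  have h2 := h1.comp (φ := fun x : (Finset.Ico i (i + k)) → ℕ => ∑ a, x a)
    (ψ := fun x : (Finset.Ico j (j + k)) → ℕ => ∑ a, x a) (by fun_prop) (by fun_prop)
  simp only [walk_add_sub]
  convert h2 using 1 <;>
  · ext ω
    exact (Finset.sum_coe_sort _ (fun a => X a ω)).symm

/-- Ergodic averages of bounded functions of the increments of the walk over `k` steps. -/
theorem ae_tendsto_average_walk_increment [IsProbabilityMeasure P]
    (hX : ∀ i, Measurable (X i)) (hXindep : iIndepFun X P)
    (hXident : ∀ i, IdentDistrib (X i) (X 0) P P) {c : ℕ → ℝ} {B : ℝ} (hB : ∀ x, |c x| ≤ B)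
    {k : ℕ} (hk : 1 ≤ k) :
    ∀ᵐ ω ∂P, Tendsto (fun n : ℕ => (n : ℝ)⁻¹ * ∑ i ∈ Finset.range n,
      c (walk X (i + 1 + k) ω - walk X (i + 1) ω)) atTop (𝓝 (∫ ω, c (walk X k ω) ∂P)) := by
  have hcm : Measurable c := measurable_from_nat
  have hid : ∀ i, IdentDistrib (fun ω => c (walk X (i + k) ω - walk X i ω))
      (fun ω => c (walk X k ω)) P P := fun i =>
    (identDistrib_walk_increment hXindep hXident i k).comp hcm
  -- Increments over `k` steps overlap, but those whose starting times are congruent modulo `k` use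
  -- disjoint sets of steps, so the strong law applies in each residue class.
  have key : ∀ r : ℕ, ∀ᵐ ω ∂P, Tendsto (fun m : ℕ => (m : ℝ)⁻¹ * ∑ a ∈ Finset.range m,
      c (walk X (a * k + r + 1 + k) ω - walk X (a * k + r + 1) ω)) atTop
      (𝓝 (∫ ω, c (walk X k ω) ∂P)) := by
    intro r
    have h := strong_law_ae (μ := P)
      (fun a ω => c (walk X (a * k + r + 1 + k) ω - walk X (a * k + r + 1) ω))
      (Integrable.of_bound ((hid _).aemeasurable_fst.aestronglyMeasurable) B
        (ae_of_all _ fun ω => hB _)) ?_ fun a => (hid _).trans (hid _).symm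
    · have he : ∫ ω, c (walk X (0 * k + r + 1 + k) ω - walk X (0 * k + r + 1) ω) ∂P
          = ∫ ω, c (walk X k ω) ∂P := (hid _).integral_eq
      simp only [smul_eq_mul] at h
      rw [he] at h
      exact h
    · have hlt : ∀ a b : ℕ, a < b → IndepFun
          (fun ω => c (walk X (a * k + r + 1 + k) ω - walk X (a * k + r + 1) ω))
          (fun ω => c (walk X (b * k + r + 1 + k) ω - walk X (b * k + r + 1) ω)) P := by
        intro a b hab
        refine (indepFun_walk_increment hX hXindep ?_).comp hcm hcm
        have := Nat.mul_le_mul_right k hab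
        rw [Nat.succ_mul] at this
        omega
      intro a b hab
      rcases lt_or_gt_of_ne hab with h | h
      · exact hlt a b h
      · exact (hlt b a h).symm
  filter_upwards [ae_all_iff.2 key] with ω hω
  exact tendsto_average_of_residues (fun i => hB _) hk hω

theorem ae_le_walk (hXpos : ∀ i, ∀ᵐ ω ∂P, 1 ≤ X i ω) (k : ℕ) : ∀ᵐ ω ∂P, k ≤ walk X k ω := by
  filter_upwards [ae_all_iff.2 hXpos] with ω hω
  exact (strictMono_walk hω).le_apply

theorem hasSum_integral_comp_walk [IsProbabilityMeasure P]
    (hX : ∀ i, Measurable (X i)) {c : ℕ → ℝ} {B : ℝ}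
    (hB : ∀ x, |c x| ≤ B) (k : ℕ) :
    HasSum (fun x => P.real {ω | walk X k ω = x} * c x) (∫ ω, c (walk X k ω) ∂P) := by
  have hm := measurable_walk hX k
  have hprob : IsProbabilityMeasure (P.map (walk X k)) :=
    Measure.isProbabilityMeasure_map hm.aemeasurable
  have hreal : ∀ x, (P.map (walk X k)).real {x} = P.real {ω | walk X k ω = x} := fun x =>
    map_measureReal_apply hm (measurableSet_singleton x)
  have hs : Summable (fun x => P.real {ω | walk X k ω = x}) := by
    refine summable_of_sum_le (c := 1) (fun x => measureReal_nonneg) fun s => ?_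
    simp only [← hreal]
    rw [sum_measureReal_singleton]
    exact measureReal_le_one
  have hint : Integrable c (P.map (walk X k)) :=
    Integrable.of_bound measurable_from_nat.aestronglyMeasurable B (ae_of_all _ hB)
  have h1 := integral_countable hint
  rw [integral_map hm.aemeasurable hint.aestronglyMeasurable] at h1
  simp only [hreal, smul_eq_mul] at h1
  rw [h1]
  refine Summable.hasSum ?_
  refine Summable.of_norm_bounded (hs.mul_right B) fun x => ?_
  rw [norm_mul, Real.norm_of_nonneg measureReal_nonneg]
  exact mul_le_mul_of_nonneg_left (hB x) measureReal_nonneg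

/-- Since `S k ≥ k` almost surely, the decreasing bound `b` can be evaluated at `k`. -/
theorem abs_integral_comp_walk_le [IsProbabilityMeasure P]
    (hXpos : ∀ i, ∀ᵐ ω ∂P, 1 ≤ X i ω) {c b : ℕ → ℝ}
    (hc : ∀ k, 1 ≤ k → |c k| ≤ b k) (hb : ∀ j k, 1 ≤ j → j ≤ k → b k ≤ b j) {k : ℕ} (hk : 1 ≤ k) :
    |∫ ω, c (walk X k ω) ∂P| ≤ b k := by
  have := norm_integral_le_of_norm_le_const (μ := P) (f := fun ω => c (walk X k ω)) (C := b k) (by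
    filter_upwards [ae_le_walk hXpos k] with ω hω
    exact (hc _ (hk.trans hω)).trans (hb _ _ hk hω))
  simpa using this

/-- Fubini for the double series over times and sites. Absolute summability comes from the bound `b
k` on the expectation of `|c (S k)|`; time 0 contributes `c 0`. -/
theorem tsum_green_mul [IsProbabilityMeasure P]
    (hX : ∀ i, Measurable (X i)) (hXpos : ∀ i, ∀ᵐ ω ∂P, 1 ≤ X i ω)
    {c b : ℕ → ℝ} (hc : ∀ k, 1 ≤ k → |c k| ≤ b k) (hb : ∀ j k, 1 ≤ j → j ≤ k → b k ≤ b j)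
    (hbs : Summable b) :
    ∑' x, green P X x * c x = c 0 + ∑' k, ∫ ω, c (walk X (k + 1) ω) ∂P := by
  obtain ⟨B, hB⟩ : ∃ B, ∀ x, |c x| ≤ B := by
    refine ⟨max |c 0| (b 1), fun x => ?_⟩
    rcases Nat.eq_zero_or_pos x with rfl | hx
    · exact le_max_left _ _
    · exact ((hc x hx).trans (hb 1 x le_rfl hx)).trans (le_max_right _ _)
  have hrow := hasSum_integral_comp_walk (P := P) hX hB
  have hrow' := hasSum_integral_comp_walk (P := P) hX (c := fun x => |c x|) (B := B)
    (by simpa using hB)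
  have hsum : Summable (Function.uncurry fun k x : ℕ => P.real {ω | walk X k ω = x} * c x) := by
    refine Summable.of_norm ?_
    refine (summable_prod_of_nonneg fun _ => norm_nonneg _).2 ⟨fun k => ?_, ?_⟩
    · simpa [Function.uncurry, abs_mul, abs_of_nonneg measureReal_nonneg] using (hrow' k).summable
    · have e : ∀ k, ∑' x, ‖Function.uncurry (fun k x : ℕ => P.real {ω | walk X k ω = x} * c x)
          (k, x)‖ = ∫ ω, |c (walk X k ω)| ∂P := by
        intro k
        simpa [Function.uncurry, abs_mul, abs_of_nonneg measureReal_nonneg] using (hrow' k).tsum_eq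
      simp only [e]
      rw [← summable_nat_add_iff 1]
      refine Summable.of_norm_bounded ((summable_nat_add_iff 1).2 hbs) fun k => ?_
      exact abs_integral_comp_walk_le hXpos (c := fun x => |c x|) (by simpa using hc) hb (by omega)
  have hcomm := hsum.tsum_comm
  simp only [tsum_mul_right] at hcomm
  have hk : Summable (fun k => ∫ ω, c (walk X k ω) ∂P) := by
    rw [← summable_nat_add_iff 1]
    refine Summable.of_norm_bounded ((summable_nat_add_iff 1).2 hbs) fun k => ?_
    exact abs_integral_comp_walk_le hXpos hc hb (by omega)
  have h0 := hk.tsum_eq_zero_add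
  simp only [walk, Finset.range_zero, Finset.sum_empty] at h0
  simp only [integral_const, probReal_univ, smul_eq_mul, one_mul] at h0
  simp only [green]
  rw [hcomm]
  simp only [fun k => (hrow k).tsum_eq]
  exact h0

end Walk

/-! ### Limit of the normalized variance along a path -/

section VarianceLimit

variable {E : Type*} {mE : MeasurableSpace E} {μ : Measure E}
  {ξ : ℕ → E → ℝ}

theorem SecondOrderStationary.covariance_eq (hst : SecondOrderStationary μ ξ) {i j : ℕ}
    (hij : i ≤ j) : cov[ξ i, ξ j; μ] = cov[ξ 0, ξ (j - i); μ] := by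
  have := hst.2 i (j - i)
  rwa [Nat.add_sub_cancel' hij] at this

theorem variance_sum_succ_of_stationary [IsProbabilityMeasure μ]
    (hξ2 : ∀ i, MemLp (ξ i) 2 μ)
    (hst : SecondOrderStationary μ ξ) {s : ℕ → ℕ} (hs : StrictMono s) (n : ℕ) :
    variance (fun x => ∑ i ∈ Finset.range (n + 1), ξ (s i) x) μ
      = (n + 1) * variance (ξ 0) μ + 2 * ∑ l ∈ Finset.range n, ∑ i ∈ Finset.range (n - l),
        cov[ξ 0, ξ (s (i + l + 1) - s i); μ] := by
  -- Grouped by the later index instead of the lag, the double sum gains a single row when `n`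
  -- grows, namely the covariances of the new variable with all earlier ones. This makes induction
  -- possible.
  have hflip := Finset.sum_range_diag_flip n
    (fun l i => cov[ξ 0, ξ (s (i + l + 1) - s i); μ])
  rw [← hflip]
  have hvar : ∀ i, cov[ξ i, ξ i; μ] = variance (ξ 0) μ := by
    intro i
    rw [hst.covariance_eq le_rfl, Nat.sub_self, covariance_self (hξ2 0).aemeasurable]
  clear hflip
  induction n with
  | zero =>
    simp only [zero_add, Finset.range_one, Finset.sum_singleton, Finset.range_zero,
      Finset.sum_empty]
    rw [← covariance_self (hξ2 (s 0)).aemeasurable, hvar]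
    simp
  | succ n ih =>
    simp only [Finset.sum_range_succ (fun i => ξ (s i) _) (n + 1)]
    rw [variance_fun_add (memLp_finsetSum _ fun i _ => hξ2 (s i)) (hξ2 (s (n + 1))), ih,
      ← covariance_self (hξ2 (s (n + 1))).aemeasurable, hvar,
      covariance_fun_sum_left' (fun i _ => hξ2 (s i)) (hξ2 (s (n + 1))),
      Finset.sum_range_succ (fun m => ∑ k ∈ Finset.range (m + 1),
        cov[ξ 0, ξ (s (m - k + k + 1) - s (m - k)); μ])]
    have e : ∑ j ∈ Finset.range (n + 1), cov[ξ (s j), ξ (s (n + 1)); μ]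
        = ∑ k ∈ Finset.range (n + 1), cov[ξ 0, ξ (s (n - k + k + 1) - s (n - k)); μ] := by
      rw [← Finset.sum_range_reflect]
      refine Finset.sum_congr rfl fun k hk => ?_
      rw [Finset.mem_range] at hk
      rw [hst.covariance_eq (hs.monotone (by omega)), Nat.sub_add_cancel (by omega : k ≤ n),
        Nat.add_sub_cancel]
    rw [e]
    push_cast
    ring

/-- Convergence of the normalized variance along a sampling sequence with ergodic increments. -/
theorem tendsto_variance_sum_div [IsProbabilityMeasure μ]
    (hξ2 : ∀ i, MemLp (ξ i) 2 μ)
    (hst : SecondOrderStationary μ ξ) {s : ℕ → ℕ} (hs : StrictMono s) {b : ℕ → ℝ}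
    (hc : ∀ k, 1 ≤ k → |cov[ξ 0, ξ k; μ]| ≤ b k) (hb : ∀ j k, 1 ≤ j → j ≤ k → b k ≤ b j)
    (hbs : Summable b) {e : ℕ → ℝ}
    (he : ∀ l, Tendsto (fun n : ℕ => (n : ℝ)⁻¹ * ∑ i ∈ Finset.range n,
      cov[ξ 0, ξ (s (i + (l + 1)) - s i); μ]) atTop (𝓝 (e l))) :
    Tendsto (fun n : ℕ => variance (fun x => ∑ i ∈ Finset.range n, ξ (s i) x) μ / n) atTop
      (𝓝 (variance (ξ 0) μ + 2 * ∑' l, e l)) := by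
  rw [← tendsto_add_atTop_iff_nat 1]
  -- Truncated subtraction makes `f n l` vanish for `l ≥ n`, so the sum over lags is a series over
  -- all `l`.
  set f : ℕ → ℕ → ℝ := fun n l => ((n : ℝ) + 1)⁻¹ * ∑ i ∈ Finset.range (n - l),
    cov[ξ 0, ξ (s (i + l + 1) - s i); μ] with hf
  have hfeq : ∀ n : ℕ, variance (fun x => ∑ i ∈ Finset.range (n + 1), ξ (s i) x) μ / (n + 1 : ℕ)
      = variance (ξ 0) μ + 2 * ∑' l, f n l := by
    intro n
    rw [tsum_eq_sum (s := Finset.range n) (fun l hl => ?_), variance_sum_succ_of_stationary hξ2 hst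
      hs, hf, ← Finset.mul_sum]
    · have : (n : ℝ) + 1 ≠ 0 := by positivity
      push_cast
      field_simp
    · rw [Finset.mem_range, not_lt] at hl
      simp [hf, Nat.sub_eq_zero_of_le hl]
  simp only [hfeq]
  refine (Tendsto.const_mul 2 ?_).const_add _
  -- Domination is uniform in `n`: the sampling times are strictly increasing, so a lag of `l + 1`
  -- samples is a time lag of at least `l + 1`.
  refine tendsto_tsum_of_dominated_convergence (bound := fun l => b (l + 1))
    ((summable_nat_add_iff 1).2 hbs) (fun l => ?_) (Eventually.of_forall fun n l => ?_)
  · have h1 := (he l).comp (tendsto_sub_atTop_nat l)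
    have h2 : Tendsto (fun n : ℕ => ((n - l : ℕ) : ℝ) / (n + 1)) atTop (𝓝 1) := by
      have h3 : Tendsto (fun n : ℕ => 1 - ((l : ℝ) + 1) * (1 / ((n : ℝ) + 1))) atTop
          (𝓝 (1 - (l + 1) * 0)) :=
        ((tendsto_one_div_add_atTop_nhds_zero_nat (𝕜 := ℝ)).const_mul _).const_sub _
      simp only [mul_zero, sub_zero] at h3
      refine h3.congr' ?_
      filter_upwards [eventually_ge_atTop l] with n hn
      rw [Nat.cast_sub hn]
      have : (n : ℝ) + 1 ≠ 0 := by positivity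
      field_simp
      ring
    have h4 := h2.mul h1
    rw [one_mul] at h4
    refine h4.congr' ?_
    filter_upwards [eventually_gt_atTop l] with n hn
    have : ((n - l : ℕ) : ℝ) ≠ 0 := by
      exact_mod_cast (by omega : n - l ≠ 0)
    simp only [Function.comp_apply, hf, add_assoc]
    field_simp
  · have hterm : ∀ i, |cov[ξ 0, ξ (s (i + l + 1) - s i); μ]| ≤ b (l + 1) := by
      intro i
      have h1 : l + 1 ≤ s (i + l + 1) - s i := by
        have : ∀ m, s i + m ≤ s (i + m) := by
          intro m
          induction m with
          | zero => simp
          | succ m ih => exact (Nat.succ_le_succ ih).trans (hs (Nat.lt_succ_self _))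
        have := this (l + 1)
        rw [← add_assoc i l 1] at this
        omega
      exact (hc _ (by omega)).trans (hb _ _ (by omega) h1)
    have hb0 : 0 ≤ b (l + 1) := (abs_nonneg _).trans (hterm 0)
    have hn : (0 : ℝ) < n + 1 := by positivity
    rw [Real.norm_eq_abs, hf, abs_mul, abs_of_pos (inv_pos.2 hn), inv_mul_le_iff₀ hn]
    refine (Finset.abs_sum_le_sum_abs _ _).trans
      ((Finset.sum_le_card_nsmul _ _ _ fun i _ => hterm i).trans ?_)
    rw [Finset.card_range, nsmul_eq_mul]
    refine mul_le_mul_of_nonneg_right ?_ hb0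
    have : ((n - l : ℕ) : ℝ) ≤ n := by exact_mod_cast Nat.sub_le n l
    linarith

end VarianceLimit

/-! ### Consequences of stationarity and of the decay condition -/

section Stationary

variable {E : Type*} {mE : MeasurableSpace E} {μ : Measure E}
  {ξ : ℕ → E → ℝ}

theorem StrictlyStationary.identDistrib_zero (hst : StrictlyStationary μ ξ) (k : ℕ) :
    IdentDistrib (ξ k) (ξ 0) μ μ := by
  have := (hst k).comp (u := fun y : ℕ → ℝ => y 0) (measurable_pi_apply 0)
  simpa [Function.comp_def] using this

theorem StrictlyStationary.secondOrderStationary (hst : StrictlyStationary μ ξ) :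
    SecondOrderStationary μ ξ := by
  have hmean : ∀ i : ℕ, ∫ x, ξ i x ∂μ = ∫ x, ξ 0 x ∂μ := fun i =>
    (hst.identDistrib_zero i).integral_eq
  refine ⟨hmean, fun i k => ?_⟩
  have h := ((hst i).comp (u := fun y : ℕ → ℝ => (y 0 - ∫ x, ξ 0 x ∂μ) * (y k - ∫ x, ξ 0 x ∂μ))
    (by fun_prop)).integral_eq
  simp only [Function.comp_def, zero_add] at h
  simp only [covariance, hmean]
  rwa [add_comm i k]

theorem StrictlyStationary.uniformIntegrable_sq [IsProbabilityMeasure μ]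
    (hst : StrictlyStationary μ ξ)
    (hξ2 : ∀ i, MemLp (ξ i) 2 μ) : UniformIntegrable (fun i x => (ξ i x) ^ 2) 1 μ :=
  MemLp.uniformIntegrable_of_identDistrib (j := 0) le_rfl ENNReal.one_ne_top
    (memLp_one_iff_integrable.2 (hξ2 0).integrable_sq) fun i =>
      (hst.identDistrib_zero i).comp (u := fun y : ℝ => y ^ 2) (by fun_prop)

theorem SecondOrderStationary.integral_sq_eq [IsProbabilityMeasure μ]
    (hst : SecondOrderStationary μ ξ)
    (hξ2 : ∀ i, MemLp (ξ i) 2 μ) (i : ℕ) : ∫ x, ξ i x ^ 2 ∂μ = ∫ x, ξ 0 x ^ 2 ∂μ := by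
  have h := hst.2 i 0
  rw [add_zero, covariance_self (hξ2 i).aemeasurable, covariance_self (hξ2 0).aemeasurable,
    variance_eq_sub (hξ2 i), variance_eq_sub (hξ2 0), hst.1 i] at h
  simpa using h

theorem WeakDependence.exists_covDecay [IsProbabilityMeasure μ]
    (hdep : WeakDependence μ ξ) (hξ : ∀ i, Measurable (ξ i))
    (hξ2 : ∀ i, MemLp (ξ i) 2 μ) :
    ∃ (g : ℕ → ℝ) (c : ℝ), (∀ k, 0 ≤ g k) ∧ Summable g ∧
      Tendsto (fun k : ℕ => (k : ℝ) ^ (3 / 2 : ℝ) * g k) atTop (𝓝 0) ∧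
      (∀ k, 1 ≤ k → g k ≤ c * (k : ℝ) ^ (-(3 / 2) : ℝ)) ∧ 0 ≤ c ∧ CovDecay μ ξ g := by
  obtain ⟨g, hg0, hθ, hanti, ε, hε0, hε1, hsum⟩ := hdep
  -- The original `g` is only controlled at positive arguments; the value 0 at `k = 0` makes the
  -- rate nonnegative everywhere.
  set g' : ℕ → ℝ := fun k => if k = 0 then 0 else g k with hg'
  have hpos : ∀ k : ℕ, 1 ≤ k → g' k = g k := fun k hk => if_neg (by omega)
  have hg'0 : ∀ k, 0 ≤ g' k := by
    intro k
    rcases Nat.eq_zero_or_pos k with rfl | hk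
    · simp [hg']
    · rw [hpos k hk]; exact hg0 _ (by exact_mod_cast hk)
  have hbound : ∀ k : ℕ, 1 ≤ k → g' k ≤ g 1 * (k : ℝ) ^ (-(3 / 2) : ℝ) := by
    intro k hk
    have hk' : (1 : ℝ) ≤ k := by exact_mod_cast hk
    have h := hanti (Set.mem_Ioi.2 zero_lt_one) (Set.mem_Ioi.2 (zero_lt_one.trans_le hk')) hk'
    simp only [Real.one_rpow, one_mul] at h
    rw [hpos k hk, Real.rpow_neg (by positivity), ← div_eq_mul_inv, le_div_iff₀ (by positivity),
      mul_comm]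
    exact h
  refine ⟨g', g 1, hg'0, ?_, ?_, hbound, hg0 1 zero_lt_one, ?_⟩
  · refine Summable.of_nonneg_of_le hg'0 (fun k => ?_)
      ((Real.summable_nat_rpow.2 (by norm_num : (-(3 / 2) : ℝ) < -1)).mul_left (g 1))
    rcases Nat.eq_zero_or_pos k with rfl | hk
    · simp [hg', Real.zero_rpow]
    · exact hbound k hk
  · have hterm := hsum.tendsto_atTop_zero
    rw [Metric.tendsto_atTop]
    intro δ hδ
    -- A single small term of the convergent series is enough: as `ε < 1` it dominates `x ^ (3/2) *
    -- g x` at `x = 2 ^ (i * ε)`, and monotonicity carries the bound to all larger arguments.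
    obtain ⟨i, hi⟩ := (hterm.eventually_lt_const hδ).exists
    refine ⟨⌈(2 : ℝ) ^ ((i : ℝ) * ε)⌉₊, fun k hk => ?_⟩
    have hx0 : (0 : ℝ) < (2 : ℝ) ^ ((i : ℝ) * ε) := by positivity
    have hkx : (2 : ℝ) ^ ((i : ℝ) * ε) ≤ k := Nat.ceil_le.1 hk
    have hk0 : (0 : ℝ) < k := hx0.trans_le hkx
    have hk1 : 1 ≤ k := by exact_mod_cast hk0
    have h := hanti (Set.mem_Ioi.2 hx0) (Set.mem_Ioi.2 hk0) hkx
    simp only at h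
    have h2 : ((2 : ℝ) ^ ((i : ℝ) * ε)) ^ (3 / 2 : ℝ) ≤ (2 : ℝ) ^ (3 * (i : ℝ) / 2) := by
      rw [← Real.rpow_mul (by norm_num)]
      refine Real.rpow_le_rpow_of_exponent_le (by norm_num) ?_
      have : (i : ℝ) * ε ≤ i := mul_le_of_le_one_right (Nat.cast_nonneg i) hε1.le
      linarith
    have h3 := mul_le_mul_of_nonneg_right h2 (hg0 _ hx0)
    rw [Real.dist_eq, sub_zero, abs_of_nonneg (mul_nonneg (by positivity) (hg'0 k)), hpos k hk1]
    linarith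
  · exact covDecay_of_theta hξ hξ2 (fun n hn => hg'0 n) fun n hn => by
      rw [hpos n hn]; exact hθ n hn

end Stationary

/-! ### Variance on the product space -/

section Sampled

variable {Ω E : Type*} {mΩ : MeasurableSpace Ω} {mE : MeasurableSpace E} {P : Measure Ω}
  {μ : Measure E}

/-- The law of total variance, without the term for the variance of the conditional mean, since that
mean is the constant `m`. The bound `V` ensures square integrability on the product. -/
theorem variance_prod_eq_integral_variance [IsProbabilityMeasure P] [IsProbabilityMeasure μ]
    {F : Ω × E → ℝ} (hF : Measurable F)
    (hF2 : ∀ ω, MemLp (fun x => F (ω, x)) 2 μ) {m V : ℝ} (hm : ∀ ω, ∫ x, F (ω, x) ∂μ = m)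
    (hV : ∀ᵐ ω ∂P, variance (fun x => F (ω, x)) μ ≤ V) :
    variance F (P.prod μ) = ∫ ω, variance (fun x => F (ω, x)) μ ∂P := by
  have hvar : ∀ ω, variance (fun x => F (ω, x)) μ = ∫ x, (F (ω, x) - m) ^ 2 ∂μ := fun ω => by
    rw [variance_eq_integral (hF2 ω).aemeasurable, hm]
  have hsqm : AEStronglyMeasurable (fun z => (F z - m) ^ 2) (P.prod μ) :=
    ((hF.sub_const m).pow_const 2).aestronglyMeasurable
  have hsq : Integrable (fun z => (F z - m) ^ 2) (P.prod μ) := by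
    refine (integrable_prod_iff hsqm).2
      ⟨ae_of_all _ fun ω => ((hF2 ω).sub (memLp_const m)).integrable_sq, ?_⟩
    refine Integrable.of_bound hsqm.norm.integral_prod_right' V ?_
    filter_upwards [hV] with ω hω
    have e : ∫ x, ‖(F (ω, x) - m) ^ 2‖ ∂μ = variance (fun x => F (ω, x)) μ := by
      rw [hvar]
      simp
    rw [e, Real.norm_of_nonneg (variance_nonneg _ _)]
    exact hω
  have hFm : MemLp (fun z => F z - m) 2 (P.prod μ) :=
    (memLp_two_iff_integrable_sq (hF.sub_const m).aestronglyMeasurable).2 hsq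
  have hFi : Integrable F (P.prod μ) := by
    have := (hFm.integrable (by norm_num)).add (integrable_const m)
    simpa [Pi.add_def] using this
  have hmean : ∫ z, F z ∂(P.prod μ) = m := by
    rw [integral_prod _ hFi]
    simp [hm]
  rw [variance_eq_integral hF.aemeasurable, hmean, integral_prod _ hsq]
  simp only [hvar]

theorem _root_.MeasureTheory.UniformIntegrable.comp_index {ι κ : Type*} {f : ι → E → ℝ}
    {p : ℝ≥0∞} (hf : UniformIntegrable f p μ) (t : κ → ι) :
    UniformIntegrable (fun k => f (t k)) p μ :=
  ⟨fun k => hf.1 (t k), fun _ hε => (hf.2.1 hε).imp fun _ h => h.imp fun _ h k => h (t k),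
    hf.2.2.imp fun _ h k => h (t k)⟩

theorem sum_Icc_one_eq_sum_range (f : ℕ → ℝ) (n : ℕ) :
    ∑ i ∈ Finset.Icc 1 n, f i = ∑ i ∈ Finset.range n, f (i + 1) := by
  rw [Finset.range_eq_Ico, Finset.sum_Ico_add' f 0 n 1]
  rfl

theorem measurable_sampled {X : ℕ → Ω → ℕ} (hX : ∀ i, Measurable (X i)) {ξ : ℕ → E → ℝ}
    (hξ : ∀ i, Measurable (ξ i)) (i : ℕ) :
    Measurable (fun z : Ω × E => ξ (walk X i z.1) z.2) := by
  have h1 : Measurable (fun z : ℕ × E => ξ z.1 z.2) :=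
    measurable_from_prod_countable_right fun n => hξ n
  exact h1.comp (((measurable_walk hX i).comp measurable_fst).prodMk measurable_snd)

end Sampled

end SampledCLT

/-! ### The main theorem -/

theorem corollary6p1
    {Ω E : Type*} [MeasurableSpace Ω] [MeasurableSpace E]
    (P : Measure Ω) [IsProbabilityMeasure P] (μ : Measure E) [IsProbabilityMeasure μ]
    -- the i.i.d. steps of the walk, with values in `{1, 2, …}`
    (X : ℕ → Ω → ℕ) (hX : ∀ i, Measurable (X i)) (hXindep : iIndepFun X P)
    (hXident : ∀ i, IdentDistrib (X i) (X 0) P P)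
    (hXpos : ∀ i, ∀ᵐ ω ∂P, 1 ≤ X i ω)
    -- the square integrable stationary process
    (ξ : ℕ → E → ℝ) (hξ : ∀ i, Measurable (ξ i)) (hξ2 : ∀ i, MemLp (ξ i) 2 μ)
    (hstat : SampledCLT.StrictlyStationary μ ξ ∨
      (SampledCLT.SecondOrderStationary μ ξ ∧ UniformIntegrable (fun i x => (ξ i x) ^ 2) 1 μ))
    (hdep : SampledCLT.WeakDependence μ ξ)
    -- the limit variance is finite and positive
    (hfin : Summable (fun x : ℕ => SampledCLT.green P X x * covariance (ξ 0) (ξ x) μ))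
    (hpos : 0 < SampledCLT.sigmaSq P X μ ξ) :
    ∃ a : ℝ≥0,
      Tendsto (fun n : ℕ =>
          (n : ℝ) * variance (fun z : Ω × E => SampledCLT.empMean X ξ n z.1 z.2) (P.prod μ))
        atTop (𝓝 (a : ℝ)) ∧
      ∀ᵐ ω ∂P, TendstoInDistribution
        (fun (n : ℕ) (x : E) =>
          Real.sqrt n * (SampledCLT.empMean X ξ n ω x - ∫ y, ξ 0 y ∂μ))
        atTop (id : ℝ → ℝ) (fun _ => μ) (gaussianReal 0 a) := by
  open SampledCLT in
  obtain ⟨hst, hui⟩ : SecondOrderStationary μ ξ ∧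
      UniformIntegrable (fun i x => (ξ i x) ^ 2) 1 μ :=
    hstat.elim (fun h => ⟨h.secondOrderStationary, h.uniformIntegrable_sq hξ2⟩) id
  obtain ⟨g, c, hg, hgs, hglim, hgb, hc0, hd⟩ := hdep.exists_covDecay hξ hξ2
  obtain ⟨K, hKdef⟩ : ∃ K, K = √(∫ x, ξ 0 x ^ 2 ∂μ) := ⟨_, rfl⟩
  have hK0 : 0 ≤ K := hKdef ▸ Real.sqrt_nonneg _
  have hK : ∀ i, √(∫ x, ξ i x ^ 2 ∂μ) ≤ K := fun i => by rw [hst.integral_sq_eq hξ2, hKdef]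
  set b : ℕ → ℝ := fun k => K * c * (k : ℝ) ^ (-(3 / 2) : ℝ) with hb
  have hbs : Summable b :=
    (Real.summable_nat_rpow.2 (by norm_num : (-(3 / 2) : ℝ) < -1)).mul_left _
  have hbanti : ∀ j k, 1 ≤ j → j ≤ k → b k ≤ b j := by
    intro j k hj hjk
    refine mul_le_mul_of_nonneg_left ?_ (mul_nonneg hK0 hc0)
    exact Real.rpow_le_rpow_of_nonpos (by exact_mod_cast hj) (by exact_mod_cast hjk) (by norm_num)
  have hcb : ∀ k, 1 ≤ k → |cov[ξ 0, ξ k; μ]| ≤ b k := by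
    intro k hk
    have h1 := hd.abs_cov_le hξ2 LipschitzWith.id (i := 0) (j := k) (by omega)
    simp only [id, Nat.sub_zero] at h1
    refine h1.trans ?_
    simp only [hb, mul_assoc]
    exact mul_le_mul (hK 0) (hgb k hk) (hg k) hK0
  have hcB : ∀ x, |cov[ξ 0, ξ x; μ]| ≤ max |cov[ξ 0, ξ 0; μ]| (b 1) := fun x => by
    rcases Nat.eq_zero_or_pos x with rfl | hx
    · exact le_max_left _ _
    · exact ((hcb x hx).trans (hbanti 1 x le_rfl hx)).trans (le_max_right _ _)
  -- The Green series counts time 0 once, so doubling it and subtracting one variance leaves one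
  -- variance plus twice the sum over positive times.
  have hσ : sigmaSq P X μ ξ
      = variance (ξ 0) μ + 2 * ∑' l, ∫ ω, cov[ξ 0, ξ (walk X (l + 1) ω); μ] ∂P := by
    rw [sigmaSq, tsum_green_mul (c := fun x => cov[ξ 0, ξ x; μ]) hX hXpos hcb hbanti hbs,
      covariance_self (hξ2 0).aemeasurable]
    ring
  obtain ⟨a, ha⟩ : ∃ a : ℝ≥0, (a : ℝ) = sigmaSq P X μ ξ := ⟨⟨_, hpos.le⟩, rfl⟩
  rw [← ha] at hσ
  -- The empirical mean starts at `S 1`, hence the sampling times `walk X (i + 1)` for `i ≥ 0`.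
  have hmono : ∀ᵐ ω ∂P, StrictMono (fun i => walk X (i + 1) ω) := by
    filter_upwards [ae_all_iff.2 hXpos] with ω hω
    exact (strictMono_walk hω).comp fun _ _ h => Nat.succ_lt_succ h
  have hvarlim : ∀ᵐ ω ∂P, Tendsto (fun n : ℕ =>
      variance (fun x => ∑ i ∈ Finset.range n, ξ (walk X (i + 1) ω) x) μ / n) atTop
      (𝓝 (a : ℝ)) := by
    filter_upwards [hmono, ae_all_iff.2 fun l : ℕ => ae_tendsto_average_walk_increment hX hXindep
      hXident hcB (k := l + 1) (by omega)] with ω hω hlim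
    rw [hσ]
    refine tendsto_variance_sum_div hξ2 hst hω hcb hbanti hbs fun l => ?_
    simpa only [add_right_comm] using hlim l
  obtain ⟨C, hC⟩ : ∃ C, C = K ^ 2 + 2 * K * ∑' k, g k := ⟨_, rfl⟩
  have hvarle : ∀ᵐ ω ∂P, ∀ n : ℕ,
      variance (fun x => ∑ i ∈ Finset.range n, ξ (walk X (i + 1) ω) x) μ ≤ n * C := by
    filter_upwards [hmono] with ω hω n
    have := (hd.comp hω).variance_sum_le (fun i => hξ2 _) hg hgs LipschitzWith.id
      (K := K) (fun i => hK _) (Finset.range n)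
    rw [Finset.card_range, ← hC] at this
    exact this
  have hmean : ∀ (n : ℕ) ω, ∫ x, ∑ i ∈ Finset.range n, ξ (walk X (i + 1) ω) x ∂μ
      = n * ∫ x, ξ 0 x ∂μ := by
    intro n ω
    rw [integral_finsetSum _ fun i _ => (hξ2 _).integrable (by norm_num)]
    simp [hst.1]
  refine ⟨a, ?_, ?_⟩
  · have hprod : ∀ n : ℕ, (n : ℝ) * variance (fun z : Ω × E => empMean X ξ n z.1 z.2) (P.prod μ)
        = ∫ ω, variance (fun x => ∑ i ∈ Finset.range n, ξ (walk X (i + 1) ω) x) μ / n ∂P := by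
      intro n
      simp only [empMean, sum_Icc_one_eq_sum_range]
      rw [variance_const_mul, variance_prod_eq_integral_variance (V := n * C)
        (F := fun z : Ω × E => ∑ i ∈ Finset.range n, ξ (walk X (i + 1) z.1) z.2)
        (Finset.measurable_fun_sum _ fun i _ => measurable_sampled hX hξ (i + 1))
        (fun ω => memLp_finsetSum _ fun i _ => hξ2 (walk X (i + 1) ω)) (hmean n)
        (by filter_upwards [hvarle] with ω hω using hω n), integral_div]
      rcases Nat.eq_zero_or_pos n with rfl | hn
      · simp
      · have : (n : ℝ) ≠ 0 := by exact_mod_cast hn.ne'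
        field_simp
    simp only [hprod]
    -- The linear variance bound `n * C`, valid along almost every path, supplies the constant
    -- dominating function.
    have hlim := tendsto_integral_filter_of_dominated_convergence (μ := P) (l := atTop)
      (F := fun (n : ℕ) ω =>
        variance (fun x => ∑ i ∈ Finset.range n, ξ (walk X (i + 1) ω) x) μ / n)
      (f := fun _ => (a : ℝ)) (fun _ => C) ?_ ?_ (integrable_const C) hvarlim
    · simpa using hlim
    · refine Eventually.of_forall fun n => ?_
      have hsm : AEStronglyMeasurable (fun z : Ω × E =>
          (∑ i ∈ Finset.range n, ξ (walk X (i + 1) z.1) z.2 - n * ∫ x, ξ 0 x ∂μ) ^ 2)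
          (P.prod μ) :=
        (((Finset.measurable_fun_sum _ fun i _ => measurable_sampled hX hξ (i + 1)).sub_const
          _).pow_const 2).aestronglyMeasurable
      have h1 := hsm.integral_prod_right'.aemeasurable.div_const (n : ℝ)
      refine h1.aestronglyMeasurable.congr (ae_of_all _ fun ω => ?_)
      simp only
      rw [variance_eq_integral (memLp_finsetSum _ fun i _ => hξ2 _).aemeasurable, hmean]
    · filter_upwards [eventually_ge_atTop 1] with n hn
      filter_upwards [hvarle] with ω hω
      have hn' : (0 : ℝ) < n := by exact_mod_cast hn
      rw [Real.norm_of_nonneg (div_nonneg (variance_nonneg _ _) hn'.le), div_le_iff₀ hn',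
        mul_comm]
      exact hω n
  · filter_upwards [hmono, hvarlim] with ω hω hlim
    have hmeas : ∀ n : ℕ, Measurable
        (fun x => √n * (empMean X ξ n ω x - ∫ y, ξ 0 y ∂μ)) := by
      intro n
      simp only [empMean]
      exact (((Finset.measurable_fun_sum _ fun i _ => hξ _).const_mul _).sub_const _).const_mul _
    have hclt := (hd.comp hω).tendsto_charFun (fun i => hξ _) (fun i => hξ2 _)
      (hui.comp_index fun i => walk X (i + 1) ω) hg hgs hglim (fun i => hK _) hlim
    have heq : ∀ (n : ℕ) x, √n * (empMean X ξ n ω x - ∫ y, ξ 0 y ∂μ)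
        = (√n)⁻¹ * (∑ i ∈ Finset.range n, ξ (walk X (i + 1) ω) x
          - ∫ y, ∑ i ∈ Finset.range n, ξ (walk X (i + 1) ω) y ∂μ) := by
      intro n x
      rw [hmean, empMean, sum_Icc_one_eq_sum_range]
      rcases Nat.eq_zero_or_pos n with rfl | hn
      · simp
      · have hn' : (0 : ℝ) < n := by exact_mod_cast hn
        have hs := Real.sqrt_pos.2 hn'
        have hs2 := Real.sq_sqrt hn'.le
        field_simp
        rw [hs2]
    refine ⟨fun n => (hmeas n).aemeasurable, aemeasurable_id, ?_⟩
    refine ProbabilityMeasure.tendsto_iff_tendsto_charFun.2 fun u => ?_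
    have h := hclt u
    simp only [ProbabilityMeasure.coe_mk, Measure.map_id, charFun_gaussianReal]
    refine Tendsto.congr (fun n => ?_) (h.trans (le_of_eq ?_))
    · rw [charFun_apply_real, integral_map (hmeas n).aemeasurable (by fun_prop)]
      refine integral_congr_ae (ae_of_all _ fun x => ?_)
      simp only [heq]
      push_cast
      ring_nf
    · congr 1
      push_cast
      congr 1
      simp
      ring
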